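/- **Lemma 3.1.** Let $n\ge 3$, let $\alpha_1\in L^\infty(\mathbb R^n)$ be real-valued with $\alpha_1(x)\ge\tilde\nu$ for almost every $x\in\mathbb R^n$, where $\tilde\nu>0$ is a constant, and let $\alpha_2\in L^\rho(\mathbb R^n)$ be real-valued, where $n\le\rho<\infty$. Let $L^2(\mathbb R^n)$ be the space of square-integrable functions with real or with complex values. Consider the operator $-\Delta+\alpha_1$ in $L^2(\mathbb R^n)$ with domain $H^2(\mathbb R^n)$, where $\Delta u$ is taken in the sense of distributions, and the operator $u\mapsto\alpha_2u$ of multiplication by $\alpha_2$ with domain $\{u\in L^2(\mathbb R^n):\alpha_2u\in L^2(\mathbb R^n)\}$. Then $-\Delta+\alpha_1$ is a bijection of $H^2(\mathbb R^n)$ onto $L^2(\mathbb R^n)$ whose inverse is bounded on $L^2(\mathbb R^n)$, the product $\alpha_2\cdot(-\Delta+\alpha_1)^{-1}f$ lies in $L^2(\mathbb R^n)$ for every $f\in L^2(\mathbb R^n)$, and the operator $$\alpha_2\circ(-\Delta+\alpha_1)^{-1}: L^2(\mathbb R^n)\to L^2(\mathbb R^n)$$ is compact. That is, multiplication by $\alpha_2$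 is relatively compact with respect to $-\Delta+\alpha_1$: it is defined on $H^2(\mathbb R^n)$, and if $(u_j)$ is a sequence in $H^2(\mathbb R^n)$ such that $(u_j)$ and $((-\Delta+\alpha_1)u_j)$ are bounded in $L^2(\mathbb R^n)$, then $(\alpha_2u_j)$ has a subsequence that converges in $L^2(\mathbb R^n)$. -/

import Mathlib

open MeasureTheory Filter Topology
open scoped ENNReal ContDiff Laplacian

noncomputable section

namespace Schroedinger

variable {𝕜 : Type*} [RCLike 𝕜] {n : ℕ}

/-- The Hilbert space `L²(ℝⁿ)` of (classes of) `𝕜`-valued functions, for Lebesgue measure. -/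
abbrev L2 (𝕜 : Type*) [RCLike 𝕜] (n : ℕ) : Type _ :=
  Lp 𝕜 2 (volume : Measure (EuclideanSpace ℝ (Fin n)))

/-- Test functions: smooth real-valued functions with compact support. -/
structure IsTest (φ : EuclideanSpace ℝ (Fin n) → ℝ) : Prop where
  smooth : ContDiff ℝ ∞ φ
  compact : HasCompactSupport φ

/-- The classical partial derivative `∂ᵢ φ`. -/
def pderiv (i : Fin n) (φ : EuclideanSpace ℝ (Fin n) → ℝ) (x : EuclideanSpace ℝ (Fin n)) : ℝ :=
  fderiv ℝ φ x (EuclideanSpace.single i 1)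

/-- `v` is the weak partial derivative `∂ᵢ u`. -/
def HasWeakPartial (i : Fin n) (u v : L2 𝕜 n) : Prop :=
  ∀ φ : EuclideanSpace ℝ (Fin n) → ℝ, IsTest φ →
    ∫ x, pderiv i φ x • u x = - ∫ x, φ x • v x

/-- `f = Δ u` in the sense of distributions. -/
def HasDistribLaplacian (u f : L2 𝕜 n) : Prop :=
  ∀ φ : EuclideanSpace ℝ (Fin n) → ℝ, IsTest φ →
    ∫ x, Δ φ x • u x = ∫ x, φ x • f x

/-- `u ∈ H²(ℝⁿ)`: all weak partial derivatives of `u` of order at most two exist in `L²`. -/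
def MemH2 (u : L2 𝕜 n) : Prop :=
  ∃ (g : Fin n → L2 𝕜 n) (h : Fin n → Fin n → L2 𝕜 n),
    (∀ i, HasWeakPartial i u (g i)) ∧ ∀ i j, HasWeakPartial j (g i) (h i j)

lemma IsTest.pderiv {φ : EuclideanSpace ℝ (Fin n) → ℝ} (hφ : IsTest φ) (i : Fin n) :
    IsTest (pderiv i φ) where
  smooth := (hφ.smooth.fderiv_right (m := ∞) (by simp)).clm_apply contDiff_const
  compact := hφ.compact.fderiv_apply (𝕜 := ℝ) _

lemma laplacian_eq {φ : EuclideanSpace ℝ (Fin n) → ℝ} (hφ : IsTest φ) :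
    Δ φ = fun x => ∑ i, pderiv i (pderiv i φ) x := by
  rw [InnerProductSpace.laplacian_eq_iteratedFDeriv_orthonormalBasis φ
    (EuclideanSpace.basisFun (Fin n) ℝ)]
  funext x
  refine Finset.sum_congr rfl fun i _ => ?_
  have h1 : DifferentiableAt ℝ (fderiv ℝ φ) x :=
    ((hφ.smooth.fderiv_right (m := ∞) (by simp)).differentiable (by simp)) x
  rw [iteratedFDeriv_two_apply]
  unfold Schroedinger.pderiv
  rw [fderiv_clm_apply h1 (differentiableAt_const _)]
  simp

lemma integrable_smul_of_isTest {φ : EuclideanSpace ℝ (Fin n) → ℝ} (hφ : IsTest φ)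
    (u : L2 𝕜 n) : Integrable (fun x => φ x • u x) :=
  ((Lp.memLp u).locallyIntegrable (by norm_num)).integrable_smul_left_of_hasCompactSupport
    hφ.smooth.continuous hφ.compact

lemma integral_smul_add {φ : EuclideanSpace ℝ (Fin n) → ℝ} (hφ : IsTest φ) (u v : L2 𝕜 n) :
    ∫ x, φ x • (u + v : L2 𝕜 n) x = (∫ x, φ x • u x) + ∫ x, φ x • v x := by
  rw [← integral_add (integrable_smul_of_isTest hφ u) (integrable_smul_of_isTest hφ v)]
  refine integral_congr_ae ?_
  filter_upwards [Lp.coeFn_add u v] with x hx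
  rw [hx, Pi.add_apply, smul_add]

lemma integral_smul_smul (φ : EuclideanSpace ℝ (Fin n) → ℝ) (c : 𝕜) (u : L2 𝕜 n) :
    ∫ x, φ x • (c • u : L2 𝕜 n) x = c • ∫ x, φ x • u x := by
  rw [← integral_smul]
  refine integral_congr_ae ?_
  filter_upwards [Lp.coeFn_smul c u] with x hx
  rw [hx, Pi.smul_apply, smul_comm]

lemma HasWeakPartial.add {i : Fin n} {u v u' v' : L2 𝕜 n} (h : HasWeakPartial i u v)
    (h' : HasWeakPartial i u' v') : HasWeakPartial i (u + u') (v + v') := by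
  intro φ hφ
  rw [integral_smul_add (hφ.pderiv i), integral_smul_add hφ, h φ hφ, h' φ hφ]
  ring

lemma HasWeakPartial.smul {i : Fin n} {u v : L2 𝕜 n} (c : 𝕜) (h : HasWeakPartial i u v) :
    HasWeakPartial i (c • u) (c • v) := by
  intro φ hφ
  rw [integral_smul_smul, integral_smul_smul, h φ hφ, smul_neg]

lemma integral_smul_zero (φ : EuclideanSpace ℝ (Fin n) → ℝ) :
    ∫ x, φ x • (0 : L2 𝕜 n) x = 0 := by
  have h := integral_smul_smul φ (0 : 𝕜) (0 : L2 𝕜 n)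
  rwa [zero_smul, zero_smul] at h

lemma hasWeakPartial_zero (i : Fin n) : HasWeakPartial i (0 : L2 𝕜 n) 0 := by
  intro φ _
  rw [integral_smul_zero, integral_smul_zero, neg_zero]

variable (𝕜 n) in
/-- The Sobolev space `H²(ℝⁿ)`, as a subspace of `L²(ℝⁿ)`. -/
def H2 : Submodule 𝕜 (L2 𝕜 n) where
  carrier := {u | MemH2 u}
  zero_mem' := ⟨fun _ => 0, fun _ _ => 0, fun i => hasWeakPartial_zero i,
    fun _ j => hasWeakPartial_zero j⟩
  add_mem' := by
    rintro u u' ⟨g, h, hg, hh⟩ ⟨g', h', hg', hh'⟩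
    exact ⟨fun i => g i + g' i, fun i j => h i j + h' i j, fun i => (hg i).add (hg' i),
      fun i j => (hh i j).add (hh' i j)⟩
  smul_mem' := by
    rintro c u ⟨g, h, hg, hh⟩
    exact ⟨fun i => c • g i, fun i j => c • h i j, fun i => (hg i).smul c,
      fun i j => (hh i j).smul c⟩

lemma HasDistribLaplacian.unique {u f f' : L2 𝕜 n} (h : HasDistribLaplacian u f)
    (h' : HasDistribLaplacian u f') : f = f' := by
  refine Lp.ext (ae_eq_of_integral_contDiff_smul_eq
    ((Lp.memLp f).locallyIntegrable (by norm_num))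
    ((Lp.memLp f').locallyIntegrable (by norm_num)) fun φ h1 h2 => ?_)
  rw [← h φ ⟨h1, h2⟩, ← h' φ ⟨h1, h2⟩]

lemma isTest_laplacian {φ : EuclideanSpace ℝ (Fin n) → ℝ} (hφ : IsTest φ) : IsTest (Δ φ) := by
  rw [laplacian_eq hφ]
  refine ⟨ContDiff.sum fun i _ => ((hφ.pderiv i).pderiv i).smooth, ?_⟩
  refine HasCompactSupport.intro hφ.compact fun x hx => Finset.sum_eq_zero fun i _ => ?_
  have hsub : ∀ ψ : EuclideanSpace ℝ (Fin n) → ℝ, tsupport (pderiv i ψ) ⊆ tsupport ψ :=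
    fun ψ => tsupport_fderiv_apply_subset ℝ _
  exact image_eq_zero_of_notMem_tsupport fun h => hx (hsub _ (hsub _ h))

lemma HasDistribLaplacian.add {u v u' v' : L2 𝕜 n} (h : HasDistribLaplacian u v)
    (h' : HasDistribLaplacian u' v') : HasDistribLaplacian (u + u') (v + v') := by
  intro φ hφ
  rw [integral_smul_add (isTest_laplacian hφ), integral_smul_add hφ, h φ hφ, h' φ hφ]

lemma HasDistribLaplacian.smul {u v : L2 𝕜 n} (c : 𝕜) (h : HasDistribLaplacian u v) :
    HasDistribLaplacian (c • u) (c • v) := by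
  intro φ hφ
  rw [integral_smul_smul, integral_smul_smul, h φ hφ]

lemma exists_hasDistribLaplacian (u : H2 𝕜 n) :
    ∃ f : L2 𝕜 n, HasDistribLaplacian (u : L2 𝕜 n) f := by
  obtain ⟨u, g, h, hg, hh⟩ := u
  refine ⟨∑ i, h i i, fun φ hφ => ?_⟩
  have hsum : ∀ s : Finset (Fin n), ∫ x, φ x • (∑ i ∈ s, h i i : L2 𝕜 n) x
      = ∑ i ∈ s, ∫ x, φ x • h i i x := by
    intro s
    induction s using Finset.cons_induction with
    | empty => rw [Finset.sum_empty, Finset.sum_empty, integral_smul_zero]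
    | cons a s ha ih => rw [Finset.sum_cons, Finset.sum_cons, integral_smul_add hφ, ih]
  rw [hsum, laplacian_eq hφ]
  simp only [Finset.sum_smul]
  rw [integral_finsetSum _ fun i _ => integrable_smul_of_isTest ((hφ.pderiv i).pderiv i) u]
  refine Finset.sum_congr rfl fun i _ => ?_
  rw [hg i _ (hφ.pderiv i), hh i i φ hφ, neg_neg]

variable (𝕜 n) in
/-- The Laplacian as an unbounded operator in `L²(ℝⁿ)` with domain `H²(ℝⁿ)`: for `u ∈ H²(ℝⁿ)`,
`Δ u` is the element of `L²(ℝⁿ)` which is the Laplacian of `u` in the sense of distributions. -/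
def laplacianOp : L2 𝕜 n →ₗ.[𝕜] L2 𝕜 n where
  domain := H2 𝕜 n
  toFun :=
    { toFun := fun u => (exists_hasDistribLaplacian u).choose
      map_add' := fun u v => (exists_hasDistribLaplacian (u + v)).choose_spec.unique
        ((exists_hasDistribLaplacian u).choose_spec.add (exists_hasDistribLaplacian v).choose_spec)
      map_smul' := fun c u => (exists_hasDistribLaplacian (c • u)).choose_spec.unique
        ((exists_hasDistribLaplacian u).choose_spec.smul c) }

lemma laplacianOp_spec (u : H2 𝕜 n) :
    HasDistribLaplacian (u : L2 𝕜 n) (laplacianOp 𝕜 n u) :=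
  (exists_hasDistribLaplacian u).choose_spec

lemma mul_add_ae (α : EuclideanSpace ℝ (Fin n) → ℝ) (u v : L2 𝕜 n) :
    (fun x => α x • (u + v : L2 𝕜 n) x) =ᵐ[volume]
      (fun x => α x • u x) + fun x => α x • v x := by
  filter_upwards [Lp.coeFn_add u v] with x hx
  rw [hx, Pi.add_apply, Pi.add_apply, smul_add]

lemma mul_smul_ae (α : EuclideanSpace ℝ (Fin n) → ℝ) (c : 𝕜) (u : L2 𝕜 n) :
    (fun x => α x • (c • u : L2 𝕜 n) x) =ᵐ[volume] c • fun x => α x • u x := by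
  filter_upwards [Lp.coeFn_smul c u] with x hx
  rw [hx, Pi.smul_apply, Pi.smul_apply, smul_comm]

variable (𝕜) in
/-- The operator of multiplication by the real function `α` in `L²(ℝⁿ)`, on its maximal domain
`{u ∈ L² : α u ∈ L²}`. -/
def mulOp (α : EuclideanSpace ℝ (Fin n) → ℝ) : L2 𝕜 n →ₗ.[𝕜] L2 𝕜 n where
  domain :=
    { carrier := {u | MemLp (fun x => α x • u x) 2 volume}
      zero_mem' := by
        have h := mul_smul_ae α (0 : 𝕜) (0 : L2 𝕜 n)
        rw [zero_smul, zero_smul] at h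
        exact (memLp_congr_ae h).2 MemLp.zero
      add_mem' := fun {u v} hu hv => (memLp_congr_ae (mul_add_ae α u v)).2 (MemLp.add hu hv)
      smul_mem' := fun c u hu =>
        (memLp_congr_ae (mul_smul_ae α c u)).2 (MemLp.const_smul hu c) }
  toFun :=
    { toFun := fun u => MemLp.toLp (fun x => α x • (u : L2 𝕜 n) x) u.2
      map_add' := fun u v => by
        rw [← MemLp.toLp_add]
        exact MemLp.toLp_congr _ _ (mul_add_ae α (u : L2 𝕜 n) (v : L2 𝕜 n))
      map_smul' := fun c u => by
        rw [RingHom.id_apply, ← MemLp.toLp_const_smul]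
        exact MemLp.toLp_congr _ _ (mul_smul_ae α c (u : L2 𝕜 n)) }

variable (𝕜) in
/-- The operator `-Δ + α` in `L²(ℝⁿ)`, with domain `{u ∈ H² : α u ∈ L²}`, which is all of
`H²(ℝⁿ)` if `α` is essentially bounded. -/
def schroedingerOp (α : EuclideanSpace ℝ (Fin n) → ℝ) : L2 𝕜 n →ₗ.[𝕜] L2 𝕜 n :=
  -laplacianOp 𝕜 n + mulOp 𝕜 α

section Operators

variable {H : Type*} [NormedAddCommGroup H] [NormedSpace 𝕜 H]

/-- `R` is the inverse, bounded and defined on all of `H`, of the unbounded operator `A`. -/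
structure IsBoundedInverse (A : H →ₗ.[𝕜] H) (R : H →L[𝕜] H) : Prop where
  right_inv : ∀ f : H, ∃ h : R f ∈ A.domain, A ⟨R f, h⟩ = f
  left_inv : ∀ u : A.domain, R (A u) = u

/-- `T` is the composition `B ∘ R`, which is defined on all of `H`. -/
def IsComp (B : H →ₗ.[𝕜] H) (R T : H →L[𝕜] H) : Prop :=
  ∀ f : H, ∃ h : R f ∈ B.domain, T f = B ⟨R f, h⟩

/-- `B` is relatively compact with respect to `A`: the domain of `B` contains that of `A`, and
whenever `(uⱼ)` and `(A uⱼ)` are bounded, `(B uⱼ)` has a convergent subsequence. -/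
def IsRelativelyCompact (A B : H →ₗ.[𝕜] H) : Prop :=
  ∃ hdom : A.domain ≤ B.domain, ∀ u : ℕ → A.domain,
    (∃ C : ℝ, ∀ j, ‖(u j : H)‖ ≤ C ∧ ‖A (u j)‖ ≤ C) →
    ∃ (v : H) (s : ℕ → ℕ), StrictMono s ∧
      Tendsto (fun j => B (Submodule.inclusion hdom (u (s j)))) atTop (𝓝 v)

end Operators

end Schroedinger

end

/-! Put `M = max ‖α₁‖_∞ ν` and `R = (-Δ + M)⁻¹`, the Fourier multiplier with symbol `(M +
4π²|ξ|²)⁻¹`. Since `-Δ + α₁ = (-Δ + M) + (α₁ - M)`, `|α₁ - M| ≤ M - ν` and `‖R‖ ≤ 1/M`, a Neumann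
series gives `(-Δ + α₁)⁻¹ = R (1 + (α₁ - M) R)⁻¹` (`exists_isBoundedInverse_schroedingerOp`). It
remains to see that `α₂ R` is compact (`exists_isComp_freeResolvent`).

No Sobolev embedding is used. If a bounded symbol `m` lies in `L²`, then `m(D)` is an integral
operator with kernel bounded in `L²`, so `β m(D)` is compact for `β ∈ L²`
(`exists_isComp_of_kernel`). Cutting `α₂` at height `K` leaves a part bounded by `K` and a tail in
`L²` of norm at most `A K^(1-ρ/2)`. Letting `K → 0` makes `α₂ m(D)` compact, and every `K` gives a
bound for its norm (`exists_isComp_fourierMul`).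

The symbol of `R` is then cut off to the balls of radius `2^N`. With `K = 2^N` the successive
differences are `O(2^-N)` precisely because `ρ ≥ n`, so the compact operators converge in norm, and
closedness of multiplication identifies the limit as `α₂ R`.

All this is done over `ℂ`; as the coefficients are real, it transfers to `𝕜` by real linear maps of
the scalars. -/

noncomputable section

namespace Schroedinger

/-! ### Weak convergence, compactness and relative compactness. -/

section Abstract

variable {𝕜 : Type*} [RCLike 𝕜] {H : Type*}

/-- In a separable Hilbert space, every sequence in a closed ball around the origin has a
subsequence that converges weakly to a point of the ball. -/
lemma exists_weakly_convergent_subseq [NormedAddCommGroup H] [InnerProductSpace 𝕜 H]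
    [CompleteSpace H] [TopologicalSpace.SeparableSpace H] {r : ℝ} (u : ℕ → H)
    (hu : ∀ j, ‖u j‖ ≤ r) :
    ∃ (v : H) (s : ℕ → ℕ), ‖v‖ ≤ r ∧ StrictMono s ∧
      ∀ g : H, Tendsto (fun j => inner 𝕜 (u (s j)) g) atTop (𝓝 (inner 𝕜 v g)) := by
  -- Sequential Banach–Alaoglu in the dual, carried back to `H` by the Riesz isometry.
  obtain ⟨w, hw, s, hs, hlim⟩ := WeakDual.isSeqCompact_closedBall 𝕜 H (0 : StrongDual 𝕜 H) r
    (x := fun j => StrongDual.toWeakDual (InnerProductSpace.toDual 𝕜 H (u j)))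
    (fun j => by simpa using hu j)
  refine ⟨(InnerProductSpace.toDual 𝕜 H).symm (WeakDual.toStrongDual w), s, ?_, hs, fun g => ?_⟩
  · simpa using hw
  · have h := ((WeakDual.eval_continuous g).tendsto w).comp hlim
    have h2 : inner 𝕜 ((InnerProductSpace.toDual 𝕜 H).symm (WeakDual.toStrongDual w)) g = w g := by
      rw [InnerProductSpace.toDual_symm_apply]; rfl
    rw [h2]
    exact h

/-- An operator that maps bounded weakly convergent sequences to norm convergent ones is
compact. -/
lemma isCompactOperator_of_weak_to_strong [NormedAddCommGroup H] [InnerProductSpace 𝕜 H]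
    [CompleteSpace H] [TopologicalSpace.SeparableSpace H] {F : Type*} [NormedAddCommGroup F]
    [NormedSpace 𝕜 F] (T : H →L[𝕜] F)
    (hT : ∀ (u : ℕ → H) (v : H), (∀ j, ‖u j‖ ≤ 1) →
      (∀ g : H, Tendsto (fun j => inner 𝕜 (u j) g) atTop (𝓝 (inner 𝕜 v g))) →
      Tendsto (fun j => T (u j)) atTop (𝓝 (T v))) :
    IsCompactOperator T := by
  have hc : IsCompact (T '' Metric.closedBall 0 1) := by
    refine IsSeqCompact.isCompact fun y hy => ?_
    choose u hu huy using hy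
    obtain ⟨v, s, hv, hs, hlim⟩ := exists_weakly_convergent_subseq (𝕜 := 𝕜) u
      (r := 1) (fun j => by simpa using hu j)
    refine ⟨T v, ⟨v, by simpa using hv, rfl⟩, s, hs, ?_⟩
    have := hT (fun j => u (s j)) v (fun j => by simpa using hu (s j)) hlim
    refine this.congr fun j => huy (s j)
  refine (isCompactOperator_iff_exists_mem_nhds_image_subset_compact _).2
    ⟨_, Metric.closedBall_mem_nhds 0 one_pos, _, hc, subset_rfl⟩

/-- On the domain of `A` one has `B u = T (A u)`, and `T` maps a bounded sequence `A uⱼ` into a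
relatively compact set. -/
lemma IsRelativelyCompact.of_isComp [NormedAddCommGroup H] [NormedSpace 𝕜 H]
    {A B : H →ₗ.[𝕜] H} {R T : H →L[𝕜] H} (hR : IsBoundedInverse A R) (hT : IsComp B R T)
    (hc : IsCompactOperator T) : IsRelativelyCompact A B := by
  have hdom : A.domain ≤ B.domain := fun u hu => by
    have h := (hT (A ⟨u, hu⟩)).1
    rwa [hR.left_inv ⟨u, hu⟩] at h
  have key : ∀ u : A.domain, B (Submodule.inclusion hdom u) = T (A u) := fun u => by
    obtain ⟨h, e⟩ := hT (A u)
    rw [e]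
    congr 1
    exact Subtype.ext (hR.left_inv u).symm
  refine ⟨hdom, fun u ⟨C, hC⟩ => ?_⟩
  have hK := hc.isCompact_closure_image_closedBall (M₁ := H) (f := (T : H →ₛₗ[RingHom.id 𝕜] H)) C
  obtain ⟨v, -, s, hs, hlim⟩ := hK.isSeqCompact (x := fun j => T (A (u j)))
    (fun j => subset_closure ⟨A (u j), by simpa using (hC j).2, rfl⟩)
  exact ⟨v, s, hs, hlim.congr fun j => (key _).symm⟩

end Abstract

/-! ### Multiplication operators composed with bounded operators. -/

section Multiplication

variable {𝕜 : Type*} [RCLike 𝕜] {n : ℕ} {α β : EuclideanSpace ℝ (Fin n) → ℝ}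
  {S S' T T' : L2 𝕜 n →L[𝕜] L2 𝕜 n}

/-- Domain conditions disappear here: the pointwise identity already puts `α • S f` in `L²`, because
`T f` is there. -/
lemma isComp_mulOp_iff :
    IsComp (mulOp 𝕜 α) S T ↔ ∀ f, T f =ᵐ[volume] fun x => α x • S f x := by
  constructor
  · intro h f
    obtain ⟨hf, e⟩ := h f
    rw [e]
    exact MemLp.coeFn_toLp hf
  · intro h f
    have hf : MemLp (fun x => α x • S f x) 2 volume := (memLp_congr_ae (h f)).1 (Lp.memLp _)
    exact ⟨hf, Lp.ext ((h f).trans (MemLp.coeFn_toLp hf).symm)⟩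

lemma IsComp.sub_right (h : IsComp (mulOp 𝕜 α) S T) (h' : IsComp (mulOp 𝕜 α) S' T') :
    IsComp (mulOp 𝕜 α) (S - S') (T - T') := by
  rw [isComp_mulOp_iff] at *
  intro f
  rw [sub_apply, sub_apply]
  filter_upwards [h f, h' f, Lp.coeFn_sub (T f) (T' f), Lp.coeFn_sub (S f) (S' f)]
    with x h1 h2 h3 h4
  rw [h3, h4, Pi.sub_apply, Pi.sub_apply, h1, h2, smul_sub]

lemma IsComp.add_left (h : IsComp (mulOp 𝕜 α) S T) (h' : IsComp (mulOp 𝕜 β) S T') :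
    IsComp (mulOp 𝕜 (α + β)) S (T + T') := by
  rw [isComp_mulOp_iff] at *
  intro f
  rw [add_apply]
  filter_upwards [h f, h' f, Lp.coeFn_add (T f) (T' f)] with x h1 h2 h3
  rw [h3, Pi.add_apply, Pi.add_apply, h1, h2, add_smul]

lemma IsComp.unique (h : IsComp (mulOp 𝕜 α) S T) (h' : IsComp (mulOp 𝕜 α) S T') : T = T' := by
  rw [isComp_mulOp_iff] at *
  ext1 f
  exact Lp.ext ((h f).trans (h' f).symm)

lemma IsComp.comp_right {B : L2 𝕜 n →ₗ.[𝕜] L2 𝕜 n} (h : IsComp B S T)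
    (K : L2 𝕜 n →L[𝕜] L2 𝕜 n) : IsComp B (S ∘L K) (T ∘L K) :=
  fun f => h (K f)

/-- Multiplication by a function is a closed operator. -/
lemma IsComp.of_tendsto {S T : ℕ → L2 𝕜 n →L[𝕜] L2 𝕜 n} {S₀ T₀ : L2 𝕜 n →L[𝕜] L2 𝕜 n}
    (h : ∀ N, IsComp (mulOp 𝕜 α) (S N) (T N)) (hS : Tendsto S atTop (𝓝 S₀))
    (hT : Tendsto T atTop (𝓝 T₀)) : IsComp (mulOp 𝕜 α) S₀ T₀ := by
  simp only [isComp_mulOp_iff] at *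
  intro f
  have hSf : Tendsto (fun N => S N f) atTop (𝓝 (S₀ f)) :=
    ((ContinuousLinearMap.apply 𝕜 (L2 𝕜 n) f).continuous.tendsto S₀).comp hS
  have hTf : Tendsto (fun N => T N f) atTop (𝓝 (T₀ f)) :=
    ((ContinuousLinearMap.apply 𝕜 (L2 𝕜 n) f).continuous.tendsto T₀).comp hT
  -- Two successive extractions yield one subsequence along which both `S N f` and `T N f` converge
  -- almost everywhere.
  obtain ⟨s, hs, hs'⟩ := (tendstoInMeasure_of_tendsto_Lp hSf).exists_seq_tendsto_ae
  obtain ⟨t, ht, ht'⟩ := (tendstoInMeasure_of_tendsto_Lp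
    (hTf.comp hs.tendsto_atTop)).exists_seq_tendsto_ae
  have hall : ∀ᵐ x, ∀ N, T N f x = α x • S N f x := ae_all_iff.2 fun N => h N f
  filter_upwards [hs', ht', hall] with x h1 h2 h3
  refine tendsto_nhds_unique h2 ?_
  simp only [Function.comp_apply, h3]
  exact (h1.comp ht.tendsto_atTop).const_smul (α x)

lemma exists_isComp_of_bound {C : ℝ} (hC : 0 ≤ C)
    (h : ∀ f, MemLp (fun x => α x • S f x) 2 volume ∧
      (eLpNorm (fun x => α x • S f x) 2 volume).toReal ≤ C * ‖f‖) :
    ∃ T : L2 𝕜 n →L[𝕜] L2 𝕜 n, IsComp (mulOp 𝕜 α) S T ∧ ‖T‖ ≤ C := by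
  let L : L2 𝕜 n →ₗ[𝕜] L2 𝕜 n :=
    (mulOp 𝕜 α).toFun ∘ₗ (S : L2 𝕜 n →ₗ[𝕜] L2 𝕜 n).codRestrict _ fun f => (h f).1
  have hL : ∀ f, L f = MemLp.toLp (fun x => α x • S f x) (h f).1 := fun f => rfl
  refine ⟨L.mkContinuous C fun f => ?_, fun f => ⟨(h f).1, rfl⟩,
    LinearMap.mkContinuous_norm_le _ hC _⟩
  rw [hL, Lp.norm_toLp]
  exact (h f).2

/-- Multiplication by an essentially bounded function. -/
def mulBdd (m : Lp 𝕜 ∞ (volume : Measure (EuclideanSpace ℝ (Fin n)))) :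
    L2 𝕜 n →L[𝕜] L2 𝕜 n :=
  (ContinuousLinearMap.lsmul 𝕜 𝕜).holderL volume ∞ 2 2 m

lemma mulBdd_coeFn (m : Lp 𝕜 ∞ (volume : Measure (EuclideanSpace ℝ (Fin n)))) (f : L2 𝕜 n) :
    mulBdd m f =ᵐ[volume] fun x => m x * f x :=
  ContinuousLinearMap.coeFn_holder _ _ _

lemma norm_mulBdd_le {m : Lp 𝕜 ∞ (volume : Measure (EuclideanSpace ℝ (Fin n)))} {C : ℝ}
    (hC : 0 ≤ C) (hm : ∀ᵐ x, ‖m x‖ ≤ C) : ‖mulBdd m‖ ≤ C := by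
  refine ContinuousLinearMap.opNorm_le_bound _ hC fun f => ?_
  refine Lp.norm_le_mul_norm_of_ae_le_mul ?_
  filter_upwards [hm, mulBdd_coeFn m f] with x h1 h2
  rw [h2, norm_mul]
  gcongr

lemma exists_isComp_of_abs_le {K : ℝ} (hα : AEStronglyMeasurable α volume) (hK : 0 ≤ K)
    (h : ∀ x, |α x| ≤ K) (S : L2 𝕜 n →L[𝕜] L2 𝕜 n) :
    ∃ T : L2 𝕜 n →L[𝕜] L2 𝕜 n, IsComp (mulOp 𝕜 α) S T ∧ ‖T‖ ≤ K * ‖S‖ := by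
  refine exists_isComp_of_bound (by positivity) fun f => ?_
  have h1 : ∀ᵐ x, ‖α x • S f x‖ ≤ K * ‖S f x‖ := by
    refine Eventually.of_forall fun x => ?_
    rw [norm_smul]
    exact mul_le_mul_of_nonneg_right (h x) (norm_nonneg _)
  have h2 : MemLp (fun x => α x • S f x) 2 volume :=
    MemLp.of_le_mul (Lp.memLp (S f)) (hα.smul (Lp.aestronglyMeasurable _)) h1
  refine ⟨h2, ?_⟩
  rw [← Lp.norm_toLp _ h2]
  refine (Lp.norm_le_mul_norm_of_ae_le_mul (g := S f) (c := K) ?_).trans ?_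
  · filter_upwards [h1, h2.coeFn_toLp] with x h3 h4
    rw [h4]
    exact h3
  · rw [mul_assoc]
    exact mul_le_mul_of_nonneg_left (S.le_opNorm f) hK

/-- If `S` is an integral operator with kernel bounded in `L²` and `α ∈ L²`, then `α ∘ S` is
compact. -/
lemma exists_isComp_of_kernel (hα : MemLp α 2 volume) {B : ℝ} (hB : 0 ≤ B)
    {k : EuclideanSpace ℝ (Fin n) → L2 𝕜 n} (hk : ∀ x, ‖k x‖ ≤ B)
    (hS : ∀ f, S f =ᵐ[volume] fun x => inner 𝕜 (k x) f) :
    ∃ T : L2 𝕜 n →L[𝕜] L2 𝕜 n, IsComp (mulOp 𝕜 α) S T ∧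
      ‖T‖ ≤ (eLpNorm α 2 volume).toReal * B ∧ IsCompactOperator T := by
  have bd : ∀ f x, ‖inner 𝕜 (k x) f‖ ≤ B * ‖f‖ := fun f x =>
    (norm_inner_le_norm _ _).trans (by gcongr; exact hk x)
  have h1 : ∀ f, ∀ᵐ x, ‖α x • S f x‖ ≤ (B * ‖f‖) * ‖α x‖ := by
    intro f
    filter_upwards [hS f] with x hx
    rw [hx, norm_smul, mul_comm]
    gcongr
    exact bd f x
  have h2 : ∀ f, MemLp (fun x => α x • S f x) 2 volume := fun f =>
    MemLp.of_le_mul hα (hα.1.smul (Lp.aestronglyMeasurable _)) (h1 f)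
  obtain ⟨T, hT, hTn⟩ := exists_isComp_of_bound (S := S) (α := α)
    (C := (eLpNorm α 2 volume).toReal * B) (by positivity) fun f => by
      refine ⟨h2 f, ?_⟩
      rw [← Lp.norm_toLp _ (h2 f), ← Lp.norm_toLp _ hα]
      refine (Lp.norm_le_mul_norm_of_ae_le_mul (g := hα.toLp) (c := B * ‖f‖) ?_).trans
        (le_of_eq (by ring))
      filter_upwards [h1 f, (h2 f).coeFn_toLp, hα.coeFn_toLp] with x h3 h4 h5
      rw [h4, h5]
      exact h3
  refine ⟨T, hT, hTn, ?_⟩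
  rw [isComp_mulOp_iff] at hT
  -- Feeds the separability of `L²`, which weak sequential compactness requires.
  have : Fact ((2 : ℝ≥0∞) ≠ ⊤) := ⟨by simp⟩
  refine isCompactOperator_of_weak_to_strong T fun u v hu huv => ?_
  rw [tendsto_iff_norm_sub_tendsto_zero]
  -- Weak convergence makes `inner (k x) (u j - v)` tend to zero at every `x`; the square of `B (1 +
  -- ‖v‖) |α|` dominates.
  have hsq : Tendsto (fun j => ‖T (u j) - T v‖ ^ 2) atTop (𝓝 0) := by
    have e : ∀ j, ‖T (u j) - T v‖ ^ 2 = ∫ x, (α x * ‖inner 𝕜 (k x) (u j - v)‖) ^ 2 := by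
      intro j
      rw [← map_sub, ← RCLike.ofReal_inj (K := 𝕜), RCLike.ofReal_pow,
        ← inner_self_eq_norm_sq_to_K (𝕜 := 𝕜), L2.inner_def, ← integral_ofReal]
      refine integral_congr_ae ?_
      filter_upwards [hT (u j - v), hS (u j - v)] with x h3 h4
      rw [inner_self_eq_norm_sq_to_K (𝕜 := 𝕜), h3, h4, norm_smul, ← RCLike.ofReal_pow, mul_pow,
        mul_pow, Real.norm_eq_abs, sq_abs]
    simp only [e]
    have hb : ∀ j, ‖u j - v‖ ≤ 1 + ‖v‖ := fun j =>
      (norm_sub_le _ _).trans (by gcongr; exact hu j)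
    have := tendsto_integral_of_dominated_convergence (μ := volume)
      (F := fun j x => (α x * ‖inner 𝕜 (k x) (u j - v)‖) ^ 2) (f := fun _ => 0)
      (fun x => (B * (1 + ‖v‖)) ^ 2 * (α x) ^ 2) ?_ (hα.integrable_sq.const_mul _) ?_ ?_
    · simpa using this
    · intro j
      have : AEStronglyMeasurable (fun x => inner 𝕜 (k x) (u j - v)) volume :=
        (Lp.aestronglyMeasurable _).congr (hS (u j - v))
      exact (hα.1.mul this.norm).pow 2
    · intro j
      refine Eventually.of_forall fun x => ?_
      rw [Real.norm_of_nonneg (sq_nonneg _), mul_pow, mul_comm]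
      gcongr
      exact (bd _ x).trans (by gcongr; exact hb j)
    · refine Eventually.of_forall fun x => ?_
      have h3 : Tendsto (fun j => inner 𝕜 (k x) (u j - v)) atTop (𝓝 0) := by
        have h4 := (huv (k x)).sub_const (inner 𝕜 v (k x))
        rw [sub_self] at h4
        -- Conjugation moves the sequence from the first slot of the inner product to the second.
        have h5 := (RCLike.continuous_conj (K := 𝕜)).tendsto 0 |>.comp h4
        rw [map_zero] at h5
        refine h5.congr fun j => ?_
        rw [Function.comp_apply, ← inner_sub_left, inner_conj_symm]
      have h6 := ((h3.norm).const_mul (α x)).pow 2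
      simpa using h6
  have := hsq.sqrt
  simpa [Real.sqrt_sq] using this

end Multiplication

/-! ### Fourier multipliers on `L²` and their kernels. -/

section Fourier

open FourierTransform SchwartzMap

variable {n : ℕ}

/-- A real test function as a complex valued Schwartz function. -/
def IsTest.toSchwartz {φ : EuclideanSpace ℝ (Fin n) → ℝ} (hφ : IsTest φ) :
    𝓢(EuclideanSpace ℝ (Fin n), ℂ) :=
  HasCompactSupport.toSchwartzMap (f := fun x => (φ x : ℂ))
    (hφ.compact.comp_left (g := fun t : ℝ => (t : ℂ)) Complex.ofReal_zero)
    (Complex.ofRealCLM.contDiff.comp hφ.smooth)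

@[simp]
lemma IsTest.toSchwartz_apply {φ : EuclideanSpace ℝ (Fin n) → ℝ} (hφ : IsTest φ)
    (x : EuclideanSpace ℝ (Fin n)) : hφ.toSchwartz x = (φ x : ℂ) := rfl

lemma integral_isTest_smul {φ : EuclideanSpace ℝ (Fin n) → ℝ} (hφ : IsTest φ) (u : L2 ℂ n) :
    ∫ x, φ x • u x = Lp.toTemperedDistribution u hφ.toSchwartz := by
  rw [Lp.toTemperedDistribution_apply]
  rfl

lemma continuous_fourierInv {w : EuclideanSpace ℝ (Fin n) → ℂ} (hw : Integrable w) :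
    Continuous (𝓕⁻ w) := by
  rw [← Real.Lp.fourierTransformInv_toLp (memLp_one_iff_integrable.2 hw)]
  exact BoundedContinuousFunction.continuous _

/-- The inverse Fourier transform on `L²` is given by the Fourier integral on `L¹ ∩ L²`. -/
lemma fourierInv_ae_eq {w : L2 ℂ n} (hw : Integrable w) :
    (𝓕⁻ w : L2 ℂ n) =ᵐ[volume] 𝓕⁻ (w : EuclideanSpace ℝ (Fin n) → ℂ) := by
  refine ae_eq_of_integral_contDiff_smul_eq ((Lp.memLp _).locallyIntegrable (by norm_num))
    (continuous_fourierInv hw).locallyIntegrable fun φ h1 h2 => ?_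
  have hφ : IsTest φ := ⟨h1, h2⟩
  rw [integral_isTest_smul hφ, ← Lp.fourierInv_toTemperedDistribution_eq,
    TemperedDistribution.fourierInv_apply, Lp.toTemperedDistribution_apply]
  rw [SchwartzMap.fourierInv_coe]
  -- Fubini moves the transform from the test function to `w`; the minus sign in the bilinear form
  -- selects the inverse transform.
  have := VectorFourier.integral_fourierIntegral_smul_eq_flip (μ := volume) (ν := volume)
    (L := -innerₗ (EuclideanSpace ℝ (Fin n))) (f := fun x => hφ.toSchwartz x)
    (g := fun x => w x)
    Real.continuous_fourierChar (by
      simp only [LinearMap.neg_apply, innerₗ_apply_apply]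
      fun_prop)
    hφ.toSchwartz.integrable hw
  have hL : (-innerₗ (EuclideanSpace ℝ (Fin n))).flip = -innerₗ (EuclideanSpace ℝ (Fin n)) := by
    ext x y
    simp [real_inner_comm]
  rw [hL] at this
  exact this

/-- The Fourier multiplier with symbol `m`. -/
def fourierMul (m : Lp ℂ ⊤ (volume : Measure (EuclideanSpace ℝ (Fin n)))) :
    L2 ℂ n →L[ℂ] L2 ℂ n :=
  ((Lp.fourierTransformₗᵢ (EuclideanSpace ℝ (Fin n)) ℂ).symm : L2 ℂ n →L[ℂ] L2 ℂ n) ∘L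
    mulBdd m ∘L ((Lp.fourierTransformₗᵢ (EuclideanSpace ℝ (Fin n)) ℂ) : L2 ℂ n →L[ℂ] L2 ℂ n)

lemma fourierMul_apply (m : Lp ℂ ⊤ (volume : Measure (EuclideanSpace ℝ (Fin n)))) (f : L2 ℂ n) :
    fourierMul m f = 𝓕⁻ (mulBdd m (𝓕 f)) := rfl

lemma fourierMul_sub (m m' : Lp ℂ ⊤ (volume : Measure (EuclideanSpace ℝ (Fin n)))) :
    fourierMul (m - m') = fourierMul m - fourierMul m' := by
  simp only [fourierMul, mulBdd, map_sub, ContinuousLinearMap.sub_comp,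
    ContinuousLinearMap.comp_sub]

lemma norm_fourierMul_le {m : Lp ℂ ⊤ (volume : Measure (EuclideanSpace ℝ (Fin n)))} {C : ℝ}
    (hC : 0 ≤ C) (hm : ∀ᵐ x, ‖m x‖ ≤ C) : ‖fourierMul m‖ ≤ C := by
  refine ContinuousLinearMap.opNorm_le_bound _ hC fun f => ?_
  have h1 : ‖fourierMul m f‖ = ‖mulBdd m (𝓕 f)‖ :=
    (Lp.fourierTransformₗᵢ (EuclideanSpace ℝ (Fin n)) ℂ).symm.norm_map _
  rw [h1, ← Lp.norm_fourier_eq f]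
  exact (mulBdd m).le_of_opNorm_le (norm_mulBdd_le hC hm) _

/-- A Fourier multiplier with square integrable symbol has a kernel that is bounded in `L²`. -/
lemma exists_kernel_fourierMul {m : Lp ℂ ⊤ (volume : Measure (EuclideanSpace ℝ (Fin n)))}
    (hm : MemLp m 2 volume) :
    ∃ k : EuclideanSpace ℝ (Fin n) → L2 ℂ n, (∀ x, ‖k x‖ = (eLpNorm m 2 volume).toReal) ∧
      ∀ f, fourierMul m f =ᵐ[volume] fun x => inner ℂ (k x) f := by
  -- By Parseval, pairing `𝓕⁻ (e x)` with `f` gives `∫ exp(2πi ξ·x) m(ξ) 𝓕f(ξ) dξ`, the value of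
  -- `m(D) f` at `x`. The phase has modulus one, so the norm does not depend on `x`.
  let e : EuclideanSpace ℝ (Fin n) → EuclideanSpace ℝ (Fin n) → ℂ := fun x ξ =>
    (starRingEnd ℂ) ((Real.fourierChar (inner ℝ ξ x) : ℂ) * m ξ)
  have hnorm : ∀ x ξ, ‖e x ξ‖ = ‖m ξ‖ := fun x ξ => by
    rw [RCLike.norm_conj, norm_mul, Circle.norm_coe, one_mul]
  have hcont : ∀ x, Continuous fun ξ : EuclideanSpace ℝ (Fin n) =>
      (Real.fourierChar (inner ℝ ξ x) : ℂ) := fun x =>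
    continuous_subtype_val.comp (Real.continuous_fourierChar.comp (by fun_prop))
  have he : ∀ x, MemLp (e x) 2 volume := fun x => by
    refine hm.of_le ?_ (Eventually.of_forall fun ξ => (hnorm x ξ).le)
    exact RCLike.continuous_conj.comp_aestronglyMeasurable
      ((hcont x).aestronglyMeasurable.mul hm.1)
  refine ⟨fun x => 𝓕⁻ ((he x).toLp), fun x => ?_, fun f => ?_⟩
  · have h1 : ‖(𝓕⁻ ((he x).toLp) : L2 ℂ n)‖ = ‖(he x).toLp‖ :=
      (Lp.fourierTransformₗᵢ (EuclideanSpace ℝ (Fin n)) ℂ).symm.norm_map _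
    rw [h1, Lp.norm_toLp, eLpNorm_congr_norm_ae (Eventually.of_forall (hnorm x))]
  · have hw : Integrable (mulBdd m (𝓕 f)) volume :=
      (hm.integrable_mul (Lp.memLp (𝓕 f : L2 ℂ n))).congr (mulBdd_coeFn m (𝓕 f)).symm
    rw [fourierMul_apply]
    filter_upwards [fourierInv_ae_eq hw] with x hx
    rw [hx, Real.fourierInv_eq]
    have h2 : inner ℂ (𝓕⁻ ((he x).toLp) : L2 ℂ n) f = inner ℂ ((he x).toLp) (𝓕 f : L2 ℂ n) := by
      rw [← Lp.inner_fourier_eq, fourier_fourierInv_eq]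
    rw [h2, L2.inner_def]
    refine integral_congr_ae ?_
    filter_upwards [mulBdd_coeFn m (𝓕 f), (he x).coeFn_toLp] with ξ h3 h4
    rw [h3, h4, RCLike.inner_apply]
    simp only [e, RingHom.map_mul, Complex.conj_conj, Circle.smul_def, smul_eq_mul]
    ring

end Fourier

/-! ### Compactness of `α (-Δ + M)⁻¹` by cutting `α` and the symbol. -/

section RelativeBound

variable {n : ℕ}

/-- Truncation of a real number at height `K`. -/
def trunc (K t : ℝ) : ℝ := if |t| ≤ K then t else 0

lemma measurable_trunc (K : ℝ) : Measurable (trunc K) :=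
  Measurable.ite (measurableSet_le (by fun_prop) measurable_const) measurable_id measurable_const

lemma abs_trunc_le {K : ℝ} (hK : 0 ≤ K) (t : ℝ) : |trunc K t| ≤ K := by
  unfold trunc
  split_ifs with h
  · exact h
  · simpa using hK

/-- Where `|t| > K`, write `|t| = |t|^(1 - r/2) |t|^(r/2)`; the first exponent is nonpositive, so
the first factor is at most its value at `K`. -/
lemma abs_sub_trunc_le {K r : ℝ} (hK : 0 < K) (hr : 2 ≤ r) (t : ℝ) :
    |t - trunc K t| ≤ K ^ (1 - r / 2) * |t| ^ (r / 2) := by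
  unfold trunc
  split_ifs with h
  · rw [sub_self, abs_zero]
    positivity
  · rw [sub_zero]
    push Not at h
    have ht : 0 < |t| := hK.trans h
    calc |t| = |t| ^ (1 - r / 2) * |t| ^ (r / 2) := by
          rw [← Real.rpow_add ht]
          simp
      _ ≤ _ := mul_le_mul_of_nonneg_right
          (Real.rpow_le_rpow_of_nonpos hK h.le (by linarith)) (by positivity)

variable {α : EuclideanSpace ℝ (Fin n) → ℝ} {ρ : ℝ≥0∞}

/-- `A` is the `L²` norm of `|α|^(ρ/2)`, finite because `α ∈ L^ρ`. -/
lemma exists_eLpNorm_sub_trunc_le (h2ρ : 2 ≤ ρ) (hρ : ρ < ⊤) (hα : MemLp α ρ volume) :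
    ∃ A : ℝ, 0 ≤ A ∧ ∀ K : ℝ, 0 < K → MemLp (fun x => α x - trunc K (α x)) 2 volume ∧
      (eLpNorm (fun x => α x - trunc K (α x)) 2 volume).toReal
        ≤ K ^ (1 - ρ.toReal / 2) * A := by
  have hr : 2 ≤ ρ.toReal := by
    have := ENNReal.toReal_mono hρ.ne h2ρ
    simpa using this
  have h1 : MemLp (fun x => ‖α x‖ ^ (ρ / 2).toReal) (ρ / (ρ / 2)) volume :=
    hα.norm_rpow_div (ρ / 2)
  have h2 : ρ / (ρ / 2) = 2 := by
    have h0 : ρ ≠ 0 := fun h => by simp [h] at h2ρ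
    rw [div_eq_mul_inv, div_eq_mul_inv, ENNReal.mul_inv (Or.inl h0) (Or.inl hρ.ne), inv_inv,
      ← mul_assoc, ENNReal.mul_inv_cancel h0 hρ.ne, one_mul]
  rw [h2, ENNReal.toReal_div, ENNReal.toReal_ofNat] at h1
  refine ⟨(eLpNorm (fun x => ‖α x‖ ^ (ρ.toReal / 2)) 2 volume).toReal, by positivity,
    fun K hK => ?_⟩
  have hb : ∀ᵐ x, ‖α x - trunc K (α x)‖
      ≤ K ^ (1 - ρ.toReal / 2) * ‖‖α x‖ ^ (ρ.toReal / 2)‖ := by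
    refine Eventually.of_forall fun x => ?_
    rw [Real.norm_of_nonneg (r := ‖α x‖ ^ _) (by positivity)]
    exact abs_sub_trunc_le hK hr (α x)
  have hm : MemLp (fun x => α x - trunc K (α x)) 2 volume := h1.of_le_mul
    (hα.1.sub ((measurable_trunc K).comp_aemeasurable hα.1.aemeasurable).aestronglyMeasurable) hb
  refine ⟨hm, ?_⟩
  rw [← Lp.norm_toLp _ hm, ← Lp.norm_toLp _ h1]
  refine Lp.norm_le_mul_norm_of_ae_le_mul ?_
  filter_upwards [hb, hm.coeFn_toLp, h1.coeFn_toLp] with x h3 h4 h5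
  rw [h4, h5]
  exact h3

/-- For `α ∈ L^ρ` with `2 ≤ ρ < ∞` and a bounded square integrable symbol `m`, the operator
`α ∘ m(D)` is compact, with a bound for its norm obtained by cutting `α` at height `K`. -/
lemma exists_isComp_fourierMul (h2ρ : 2 ≤ ρ) (hρ : ρ < ⊤) (hα : MemLp α ρ volume) :
    ∃ A : ℝ, 0 ≤ A ∧ ∀ (m : Lp ℂ ⊤ (volume : Measure (EuclideanSpace ℝ (Fin n)))) (b : ℝ),
      0 ≤ b → (∀ᵐ x, ‖m x‖ ≤ b) → MemLp m 2 volume →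
      ∃ T : L2 ℂ n →L[ℂ] L2 ℂ n, IsComp (mulOp ℂ α) (fourierMul m) T ∧ IsCompactOperator T ∧
        ∀ K : ℝ, 0 < K →
          ‖T‖ ≤ K * b + K ^ (1 - ρ.toReal / 2) * A * (eLpNorm m 2 volume).toReal := by
  obtain ⟨A, hA, htail⟩ := exists_eLpNorm_sub_trunc_le h2ρ hρ hα
  refine ⟨A, hA, fun m b hb hmb hm => ?_⟩
  obtain ⟨k, hk, hkm⟩ := exists_kernel_fourierMul hm
  have hnm := norm_fourierMul_le hb hmb
  have H : ∀ K : ℝ, 0 < K → ∃ D D' : L2 ℂ n →L[ℂ] L2 ℂ n,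
      IsComp (mulOp ℂ α) (fourierMul m) (D + D') ∧ ‖D‖ ≤ K * b ∧
      ‖D'‖ ≤ K ^ (1 - ρ.toReal / 2) * A * (eLpNorm m 2 volume).toReal ∧
      IsCompactOperator D' := by
    intro K hK
    obtain ⟨D, hD, hDn⟩ := exists_isComp_of_abs_le (𝕜 := ℂ) (α := fun x => trunc K (α x))
      ((measurable_trunc K).comp_aemeasurable hα.1.aemeasurable).aestronglyMeasurable hK.le
      (fun x => abs_trunc_le hK.le _) (fourierMul m)
    obtain ⟨hmem, hle⟩ := htail K hK
    obtain ⟨D', hD', hDn', hDc⟩ := exists_isComp_of_kernel (𝕜 := ℂ) hmem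
      ENNReal.toReal_nonneg (fun x => (hk x).le) hkm
    refine ⟨D, D', ?_, hDn.trans (by gcongr), hDn'.trans (by gcongr), hDc⟩
    have := hD.add_left hD'
    rwa [show (fun x => trunc K (α x)) + (fun x => α x - trunc K (α x)) = α from
      funext fun x => by simp] at this
  obtain ⟨D, D', hT, -⟩ := H 1 one_pos
  refine ⟨D + D', hT, ?_, fun K hK => ?_⟩
  -- The operator does not depend on the height `K`, by `IsComp.unique`. It differs from the compact
  -- tail part by at most `K * b` in norm, so `K → 0` gives compactness.
  · choose! E E' hE hEn _ hEc using H
    have hlim : Tendsto (fun j : ℕ => E' (1 / ((j : ℝ) + 1))) atTop (𝓝 (D + D')) := by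
      rw [tendsto_iff_norm_sub_tendsto_zero]
      have h0 : Tendsto (fun j : ℕ => 1 / ((j : ℝ) + 1) * b) atTop (𝓝 0) := by
        simpa using tendsto_one_div_add_atTop_nhds_zero_nat.mul_const b
      refine squeeze_zero (fun _ => norm_nonneg _) (fun j => ?_) h0
      have hj : (0 : ℝ) < 1 / ((j : ℝ) + 1) := by positivity
      rw [hT.unique (hE _ hj), norm_sub_rev, add_sub_cancel_right]
      exact hEn _ hj
    exact isCompactOperator_of_tendsto hlim
      (Eventually.of_forall fun j => hEc _ (by positivity))
  · obtain ⟨E, E', hE, hEn, hEn', -⟩ := H K hK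
    rw [hT.unique hE]
    exact (norm_add_le _ _).trans (add_le_add hEn hEn')

/-- The symbol of `(-Δ + M)⁻¹`. -/
def resolventSymbol (M : ℝ) (ξ : EuclideanSpace ℝ (Fin n)) : ℂ :=
  ((M + (2 * Real.pi) ^ 2 * ‖ξ‖ ^ 2)⁻¹ : ℝ)

variable {M : ℝ}

lemma norm_resolventSymbol_eq (hM : 0 < M) (ξ : EuclideanSpace ℝ (Fin n)) :
    ‖resolventSymbol M ξ‖ = (M + (2 * Real.pi) ^ 2 * ‖ξ‖ ^ 2)⁻¹ := by
  rw [resolventSymbol, Complex.norm_real, Real.norm_of_nonneg (by positivity)]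

lemma norm_resolventSymbol_le (hM : 0 < M) (ξ : EuclideanSpace ℝ (Fin n)) :
    ‖resolventSymbol M ξ‖ ≤ M⁻¹ := by
  rw [norm_resolventSymbol_eq hM]
  gcongr
  have : 0 ≤ (2 * Real.pi) ^ 2 * ‖ξ‖ ^ 2 := by positivity
  linarith

lemma norm_resolventSymbol_le_of_lt (hM : 0 < M) {ξ : EuclideanSpace ℝ (Fin n)} {r : ℝ}
    (hr : 0 < r) (h : r < ‖ξ‖) : ‖resolventSymbol M ξ‖ ≤ (r ^ 2)⁻¹ := by
  rw [norm_resolventSymbol_eq hM]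
  gcongr
  have h1 : 1 ≤ (2 * Real.pi) ^ 2 := by nlinarith [Real.pi_gt_three]
  have h2 : r ^ 2 ≤ ‖ξ‖ ^ 2 := by gcongr
  nlinarith [sq_nonneg r]

lemma continuous_resolventSymbol (hM : 0 < M) :
    Continuous (resolventSymbol M : EuclideanSpace ℝ (Fin n) → ℂ) := by
  refine Complex.continuous_ofReal.comp (Continuous.inv₀ (by fun_prop) fun ξ => ?_)
  positivity

lemma memLp_top_resolventSymbol (hM : 0 < M) :
    MemLp (resolventSymbol M : EuclideanSpace ℝ (Fin n) → ℂ) ⊤ volume :=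
  memLp_top_of_bound (continuous_resolventSymbol hM).aestronglyMeasurable _
    (Eventually.of_forall (norm_resolventSymbol_le hM))

variable (n) in
/-- The operator `(-Δ + M)⁻¹` as a Fourier multiplier. -/
def freeResolvent (hM : 0 < M) : L2 ℂ n →L[ℂ] L2 ℂ n :=
  fourierMul (memLp_top_resolventSymbol hM).toLp

lemma norm_freeResolvent_le (hM : 0 < M) : ‖freeResolvent n hM‖ ≤ M⁻¹ := by
  refine norm_fourierMul_le (by positivity) ?_
  filter_upwards [(memLp_top_resolventSymbol (n := n) hM).coeFn_toLp] with ξ h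
  rw [h]
  exact norm_resolventSymbol_le hM ξ

/-- Multiplication by `α ∈ L^ρ`, with `ρ ≥ 2` and `ρ ≥ n`, is compact relative to the
Laplacian. -/
lemma exists_isComp_freeResolvent (hM : 0 < M) (h2ρ : 2 ≤ ρ) (hnρ : (n : ℝ≥0∞) ≤ ρ) (hρ : ρ < ⊤)
    (hα : MemLp α ρ volume) :
    ∃ T : L2 ℂ n →L[ℂ] L2 ℂ n, IsComp (mulOp ℂ α) (freeResolvent n hM) T ∧
      IsCompactOperator T := by
  obtain ⟨A, hA, H⟩ := exists_isComp_fourierMul h2ρ hρ hα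
  -- The cutoffs of the symbol to the balls of radius `2 ^ N` are square integrable, and the
  -- discarded part is at most `4 ^ (-N)`.
  let B : ℕ → Set (EuclideanSpace ℝ (Fin n)) := fun N => Metric.closedBall 0 (2 ^ N)
  have hBm : ∀ N, MeasurableSet (B N) := fun N => measurableSet_closedBall
  have hBf : ∀ N, volume (B N) ≠ ⊤ := fun N => measure_closedBall_lt_top.ne
  have hc : ∀ N, MemLp ((B N).indicator (resolventSymbol M)) ⊤ volume := fun N =>
    (memLp_top_resolventSymbol hM).indicator (hBm N)
  let c : ℕ → Lp ℂ ⊤ (volume : Measure (EuclideanSpace ℝ (Fin n))) := fun N => (hc N).toLp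
  have hcc : ∀ N, c N =ᵐ[volume] (B N).indicator (resolventSymbol M) := fun N =>
    (hc N).coeFn_toLp
  have hc1 : ∀ N, ∀ᵐ x, ‖c N x‖ ≤ M⁻¹ := fun N => by
    filter_upwards [hcc N] with x hx
    rw [hx]
    exact (norm_indicator_le_norm_self _ _).trans (norm_resolventSymbol_le hM x)
  have hc2 : ∀ N, MemLp (c N) 2 volume := fun N => by
    refine (memLp_congr_ae (hcc N)).2 ?_
    rw [memLp_indicator_iff_restrict (hBm N)]
    have : IsFiniteMeasure (volume.restrict (B N)) := ⟨by simpa using (hBf N).lt_top⟩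
    exact ((memLp_top_resolventSymbol hM).restrict _).mono_exponent le_top
  choose T hT hTc _ using fun N => H (c N) M⁻¹ (by positivity) (hc1 N) (hc2 N)
  have hdecay : ∀ (N : ℕ) (x : EuclideanSpace ℝ (Fin n)), (2 : ℝ) ^ N < ‖x‖ →
      ‖resolventSymbol M x‖ ≤ ((1 : ℝ) / 4) ^ N := fun N x hx => by
    refine (norm_resolventSymbol_le_of_lt hM (by positivity) hx).trans (le_of_eq ?_)
    rw [one_div, inv_pow, ← pow_mul, mul_comm, pow_mul]
    norm_num
  have hsym : Tendsto (fun N => fourierMul (c N)) atTop (𝓝 (freeResolvent n hM)) := by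
    rw [tendsto_iff_norm_sub_tendsto_zero]
    have h0 : Tendsto (fun N : ℕ => ((1 : ℝ) / 4) ^ N) atTop (𝓝 0) :=
      tendsto_pow_atTop_nhds_zero_of_lt_one (by norm_num) (by norm_num)
    refine squeeze_zero (fun _ => norm_nonneg _) (fun N => ?_) h0
    rw [freeResolvent, ← fourierMul_sub]
    refine norm_fourierMul_le (by positivity) ?_
    filter_upwards [hcc N, (memLp_top_resolventSymbol (n := n) hM).coeFn_toLp,
      Lp.coeFn_sub (c N) (memLp_top_resolventSymbol hM).toLp] with x h1 h2 h3
    rw [h3, Pi.sub_apply, h1, h2]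
    by_cases hx : x ∈ B N
    · rw [Set.indicator_of_mem hx, sub_self, norm_zero]
      positivity
    · rw [Set.indicator_of_notMem hx, zero_sub, norm_neg]
      exact hdecay N x (by simpa [B] using hx)
  have hr : 2 ≤ ρ.toReal := by simpa using ENNReal.toReal_mono hρ.ne h2ρ
  have hnr : (n : ℝ) ≤ ρ.toReal := by simpa using ENNReal.toReal_mono hρ.ne hnρ
  let V : ℝ := (volume (Metric.ball (0 : EuclideanSpace ℝ (Fin n)) 1)).toReal
  have hV : ∀ N, (volume (B N)).toReal = ((2 : ℝ) ^ N) ^ n * V := fun N => by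
    simp only [B]
    rw [Measure.addHaar_closedBall _ _ (by positivity), ENNReal.toReal_mul,
      ENNReal.toReal_ofReal (by positivity), finrank_euclideanSpace_fin]
  -- `c (N + 1) - c N` lives on a dyadic shell, where it is at most `4 ^ (-N)`; its `L²` norm
  -- follows from the volume of the larger ball.
  have hstep : ∀ N, dist (T N) (T (N + 1))
      ≤ (1 + A * ((2 : ℝ) ^ ((n : ℝ) / 2) * V ^ (1 / 2 : ℝ))) * ((1 : ℝ) / 2) ^ N := by
    intro N
    have hm1 : ∀ᵐ x, ‖(c (N + 1) - c N) x‖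
        ≤ ‖(B (N + 1)).indicator (fun _ => ((1 : ℝ) / 4) ^ N) x‖ := by
      filter_upwards [hcc N, hcc (N + 1), Lp.coeFn_sub (c (N + 1)) (c N)] with x h1 h2 h3
      rw [h3, Pi.sub_apply, h1, h2]
      by_cases hx : x ∈ B N
      · have hx' : x ∈ B (N + 1) :=
          Metric.closedBall_subset_closedBall (pow_le_pow_right₀ (by norm_num) (by simp)) hx
        rw [Set.indicator_of_mem hx, Set.indicator_of_mem hx', sub_self, norm_zero]
        positivity
      · rw [Set.indicator_of_notMem hx, sub_zero]
        by_cases hx' : x ∈ B (N + 1)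
        · rw [Set.indicator_of_mem hx', Set.indicator_of_mem hx',
            Real.norm_of_nonneg (by positivity)]
          exact hdecay N x (by simpa [B] using hx)
        · rw [Set.indicator_of_notMem hx', Set.indicator_of_notMem hx', norm_zero, norm_zero]
    have hm2 : ∀ᵐ x, ‖(c (N + 1) - c N) x‖ ≤ ((1 : ℝ) / 4) ^ N := by
      filter_upwards [hm1] with x hx
      refine hx.trans ((norm_indicator_le_norm_self _ _).trans (le_of_eq ?_))
      exact Real.norm_of_nonneg (by positivity)
    have hm3 : MemLp (c (N + 1) - c N : Lp ℂ ⊤ volume) 2 volume :=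
      (memLp_congr_ae (Lp.coeFn_sub _ _)).2 ((hc2 _).sub (hc2 _))
    have hm4 : (eLpNorm (c (N + 1) - c N : Lp ℂ ⊤ volume) 2 volume).toReal
        ≤ ((1 : ℝ) / 4) ^ N * (((2 : ℝ) ^ (N + 1)) ^ n * V) ^ (1 / 2 : ℝ) := by
      have h1 := eLpNorm_mono_ae (p := 2) hm1
      rw [eLpNorm_indicator_const (hBm _) (by norm_num) (by norm_num)] at h1
      have h2 := ENNReal.toReal_mono (by
        refine ENNReal.mul_ne_top (by simp) ?_
        exact ENNReal.rpow_ne_top_of_nonneg (by simp) (hBf _)) h1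
      rw [ENNReal.toReal_mul, ← ENNReal.toReal_rpow, hV] at h2
      refine h2.trans (le_of_eq ?_)
      rw [toReal_enorm, Real.norm_of_nonneg (by positivity)]
      simp
    obtain ⟨D, hD, -, hDn⟩ := H (c (N + 1) - c N) (((1 : ℝ) / 4) ^ N) (by positivity) hm2 hm3
    rw [fourierMul_sub] at hD
    rw [dist_comm, dist_eq_norm, ((hT (N + 1)).sub_right (hT N)).unique hD]
    -- Cutting `α` at height `2 ^ N` makes the bounded part contribute exactly `2 ^ (-N)`.
    refine (hDn (2 ^ N) (by positivity)).trans ?_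
    rw [add_mul, one_mul]
    have e1 : (2 : ℝ) ^ N * (1 / 4) ^ N = (1 / 2) ^ N := by rw [← mul_pow]; norm_num
    rw [e1]
    gcongr (1 / 2) ^ N + ?_
    have hV0 : 0 ≤ V := ENNReal.toReal_nonneg
    -- In powers of two the left exponent is `n/2 - N + N (n - ρ)/2`, so `n ≤ ρ` is what is needed,
    -- endpoint included.
    have e2 : ((2 : ℝ) ^ N) ^ (1 - ρ.toReal / 2) * ((1 / 4) ^ N *
        (((2 : ℝ) ^ (N + 1)) ^ n) ^ (1 / 2 : ℝ)) ≤ 2 ^ ((n : ℝ) / 2) * (1 / 2) ^ N := by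
      have a1 : ((2 : ℝ) ^ N) ^ (1 - ρ.toReal / 2) = 2 ^ ((N : ℝ) * (1 - ρ.toReal / 2)) := by
        rw [Real.rpow_mul (by norm_num), Real.rpow_natCast]
      have a2 : ((1 : ℝ) / 4) ^ N = 2 ^ (-2 * (N : ℝ)) := by
        rw [Real.rpow_mul (by norm_num), Real.rpow_natCast]
        norm_num
      have a3 : (((2 : ℝ) ^ (N + 1)) ^ n) ^ (1 / 2 : ℝ)
          = 2 ^ (((N : ℝ) + 1) * n * (1 / 2)) := by
        rw [Real.rpow_mul (by norm_num), Real.rpow_mul (by norm_num), Real.rpow_natCast]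
        norm_cast
      have a4 : ((1 : ℝ) / 2) ^ N = 2 ^ (-(N : ℝ)) := by
        rw [Real.rpow_neg (by norm_num), Real.rpow_natCast]
        simp
      rw [a1, a2, a3, a4, ← Real.rpow_add (by norm_num), ← Real.rpow_add (by norm_num),
        ← Real.rpow_add (by norm_num)]
      refine Real.rpow_le_rpow_of_exponent_le (by norm_num) ?_
      have hN : (0 : ℝ) ≤ N := by positivity
      nlinarith
    calc ((2 : ℝ) ^ N) ^ (1 - ρ.toReal / 2) * A
          * (eLpNorm (c (N + 1) - c N : Lp ℂ ⊤ volume) 2 volume).toReal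
        ≤ ((2 : ℝ) ^ N) ^ (1 - ρ.toReal / 2) * A
          * (((1 : ℝ) / 4) ^ N * (((2 : ℝ) ^ (N + 1)) ^ n * V) ^ (1 / 2 : ℝ)) := by gcongr
      _ = A * V ^ (1 / 2 : ℝ) * (((2 : ℝ) ^ N) ^ (1 - ρ.toReal / 2) * ((1 / 4) ^ N *
        (((2 : ℝ) ^ (N + 1)) ^ n) ^ (1 / 2 : ℝ))) := by
          rw [Real.mul_rpow (by positivity) hV0]
          ring
      _ ≤ A * V ^ (1 / 2 : ℝ) * (2 ^ ((n : ℝ) / 2) * (1 / 2) ^ N) := by gcongr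
      _ = A * (2 ^ ((n : ℝ) / 2) * V ^ (1 / 2 : ℝ)) * (1 / 2) ^ N := by ring
  have hcau : CauchySeq T := cauchySeq_of_le_geometric (1 / 2) _ (by norm_num) hstep
  obtain ⟨T₀, hT₀⟩ := cauchySeq_tendsto_of_complete hcau
  exact ⟨T₀, IsComp.of_tendsto hT hsym hT₀,
    isCompactOperator_of_tendsto hT₀ (Eventually.of_forall hTc)⟩

end RelativeBound

/-! ### Weak derivatives tested against noncompact smooth functions. -/

section WeakDerivatives

variable {𝕜 : Type*} [RCLike 𝕜] {n : ℕ}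

lemma integrable_smul_of_memLp_two {φ : EuclideanSpace ℝ (Fin n) → ℝ} (hφ : MemLp φ 2 volume)
    (u : L2 𝕜 n) : Integrable (fun x => φ x • u x) :=
  memLp_one_iff_integrable.1 ((Lp.memLp u).smul hφ)

lemma pderiv_mul {φ ψ : EuclideanSpace ℝ (Fin n) → ℝ} (i : Fin n) {x : EuclideanSpace ℝ (Fin n)}
    (hφ : DifferentiableAt ℝ φ x) (hψ : DifferentiableAt ℝ ψ x) :
    pderiv i (fun x => φ x * ψ x) x = φ x * pderiv i ψ x + pderiv i φ x * ψ x := by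
  unfold pderiv
  rw [fderiv_fun_mul hφ hψ]
  simp [mul_comm]

lemma pderiv_comp_smul (φ : EuclideanSpace ℝ (Fin n) → ℝ) (i : Fin n)
    (c : ℝ) (x : EuclideanSpace ℝ (Fin n)) :
    pderiv i (fun x => φ (c • x)) x = c * pderiv i φ (c • x) := by
  unfold pderiv
  rw [fderiv_comp_smul]
  simp

/-- The defining identity of a weak partial derivative extends from test functions to smooth
functions that are square integrable together with their partial derivative. -/
lemma HasWeakPartial.integral_of_memLp {i : Fin n} {u v : L2 𝕜 n} (h : HasWeakPartial i u v)
    {φ : EuclideanSpace ℝ (Fin n) → ℝ} (hs : ContDiff ℝ ∞ φ) (h2 : MemLp φ 2 volume)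
    (h2' : MemLp (pderiv i φ) 2 volume) :
    ∫ x, pderiv i φ x • u x = - ∫ x, φ x • v x := by
  let χ : ContDiffBump (0 : EuclideanSpace ℝ (Fin n)) := ⟨1, 2, one_pos, one_lt_two⟩
  have hχ : IsTest (χ : EuclideanSpace ℝ (Fin n) → ℝ) := ⟨χ.contDiff, χ.hasCompactSupport⟩
  obtain ⟨C, hC⟩ := (hχ.pderiv i).compact.exists_bound_of_continuous
    (hχ.pderiv i).smooth.continuous
  -- Cutting off with `χ (c N • x)` costs an extra term of size at most `c N * C * |φ|`, which
  -- vanishes in the limit.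
  let c : ℕ → ℝ := fun N => 1 / ((N : ℝ) + 1)
  have hc0 : ∀ N, 0 < c N := fun N => by positivity
  have hc1 : ∀ N, c N ≤ 1 := fun N => by
    simp only [c]
    rw [div_le_one (by positivity)]
    simp
  have hc : Tendsto c atTop (𝓝 0) := tendsto_one_div_add_atTop_nhds_zero_nat
  have hcx : ∀ x : EuclideanSpace ℝ (Fin n), Tendsto (fun N => c N • x) atTop (𝓝 0) := fun x => by
    simpa using hc.smul_const x
  let χN : ℕ → EuclideanSpace ℝ (Fin n) → ℝ := fun N x => χ (c N • x)
  have hχN : ∀ N, ContDiff ℝ ∞ (χN N) := fun N =>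
    hχ.smooth.comp (contDiff_const_smul (c N))
  have htest : ∀ N, IsTest (fun x => χN N x * φ x) := fun N => by
    refine ⟨(hχN N).mul hs, HasCompactSupport.mul_right ?_⟩
    exact hχ.compact.comp_smul (hc0 N).ne'
  have hlim : ∀ x, Tendsto (fun N => χN N x) atTop (𝓝 1) := fun x => by
    have := (χ.continuous.tendsto 0).comp (hcx x)
    rwa [χ.one_of_mem_closedBall (by simp [χ])] at this
  have hχ1 : ∀ N x, |χN N x| ≤ 1 := fun N x => by
    rw [abs_of_nonneg χ.nonneg]
    exact χ.le_one
  have hpd : ∀ N x, pderiv i (fun x => χN N x * φ x) x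
      = χN N x * pderiv i φ x + c N * pderiv i χ (c N • x) * φ x := fun N x => by
    rw [pderiv_mul i ((hχN N).differentiable (by simp) x) (hs.differentiable (by simp) x),
      pderiv_comp_smul]
  have hR : Tendsto (fun N => ∫ x, (χN N x * φ x) • v x) atTop (𝓝 (∫ x, φ x • v x)) := by
    refine tendsto_integral_of_dominated_convergence (fun x => ‖φ x • v x‖)
      (fun N => ?_) ?_ (fun N => Eventually.of_forall fun x => ?_)
      (Eventually.of_forall fun x => ?_)
    · exact (htest N).smooth.continuous.aestronglyMeasurable.smul (Lp.aestronglyMeasurable v)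
    · exact ((integrable_smul_of_memLp_two h2 v)).norm
    · rw [mul_smul, norm_smul]
      exact mul_le_of_le_one_left (norm_nonneg _) (hχ1 N x)
    · simpa using ((hlim x).mul_const (φ x)).smul_const (v x)
  have hL : Tendsto (fun N => ∫ x, pderiv i (fun x => χN N x * φ x) x • u x) atTop
      (𝓝 (∫ x, pderiv i φ x • u x)) := by
    refine tendsto_integral_of_dominated_convergence
      (fun x => ‖pderiv i φ x • u x‖ + C * ‖φ x • u x‖)
      (fun N => ?_) ?_ (fun N => Eventually.of_forall fun x => ?_)
      (Eventually.of_forall fun x => ?_)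
    · exact ((htest N).pderiv i).smooth.continuous.aestronglyMeasurable.smul
        (Lp.aestronglyMeasurable u)
    · exact ((integrable_smul_of_memLp_two h2' u)).norm.add
        (((integrable_smul_of_memLp_two h2 u)).norm.const_mul C)
    · rw [hpd, add_smul, mul_smul, mul_smul _ (φ x)]
      refine (norm_add_le _ _).trans (add_le_add ?_ ?_)
      · rw [norm_smul]
        exact mul_le_of_le_one_left (norm_nonneg _) (hχ1 N x)
      · rw [norm_smul _ (φ x • u x), norm_mul, Real.norm_of_nonneg (hc0 N).le]
        gcongr
        exact (mul_le_of_le_one_left (norm_nonneg _) (hc1 N)).trans (hC _)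
    · simp only [hpd]
      have h3 : Tendsto (fun N => c N * pderiv i χ (c N • x)) atTop (𝓝 0) := by
        have h4 := ((hχ.pderiv i).smooth.continuous.tendsto 0).comp (hcx x)
        simpa using hc.mul h4
      have h5 := (((hlim x).mul_const (pderiv i φ x)).add (h3.mul_const (φ x))).smul_const (u x)
      simpa using h5
  refine tendsto_nhds_unique hL ?_
  refine (hR.neg).congr fun N => ?_
  exact (h _ (htest N)).symm

end WeakDerivatives

/-! ### Weak derivatives as derivatives of tempered distributions. -/

section Distributions

open SchwartzMap LineDeriv

variable {n : ℕ} {u v f : L2 ℂ n}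

lemma IsTest.lineDerivOp_toSchwartz {φ : EuclideanSpace ℝ (Fin n) → ℝ} (hφ : IsTest φ)
    (i : Fin n) :
    ∂_{(EuclideanSpace.single i (1 : ℝ) : EuclideanSpace ℝ (Fin n))} hφ.toSchwartz
      = (hφ.pderiv i).toSchwartz := by
  ext x
  have hd : DifferentiableAt ℝ φ x := hφ.smooth.differentiable (by simp) x
  rw [SchwartzMap.lineDerivOp_apply_eq_fderiv]
  have : HasFDerivAt (fun x => (φ x : ℂ)) (Complex.ofRealCLM ∘L fderiv ℝ φ x) x :=
    Complex.ofRealCLM.hasFDerivAt.comp x hd.hasFDerivAt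
  have h2 : fderiv ℝ hφ.toSchwartz x = Complex.ofRealCLM ∘L fderiv ℝ φ x := this.fderiv
  rw [h2]
  rfl

/-- Passes from real compactly supported test functions to complex Schwartz functions, by
`HasWeakPartial.integral_of_memLp` applied to real and imaginary parts. This opens the way to the
Fourier calculus. -/
lemma hasWeakPartial_iff_lineDerivOp_eq {i : Fin n} :
    HasWeakPartial i u v ↔
      ∂_{(EuclideanSpace.single i (1 : ℝ) : EuclideanSpace ℝ (Fin n))}
        (Lp.toTemperedDistribution u) = Lp.toTemperedDistribution v := by
  constructor
  · intro h
    ext ψ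
    set ψ' := ∂_{(EuclideanSpace.single i (1 : ℝ) : EuclideanSpace ℝ (Fin n))} ψ with hψ'
    rw [TemperedDistribution.lineDerivOp_apply_apply, map_neg, ← hψ',
      Lp.toTemperedDistribution_apply, Lp.toTemperedDistribution_apply, neg_eq_iff_eq_neg]
    have key : ∀ L : ℂ →L[ℝ] ℝ,
        ∫ x, L (ψ' x) • u x = - ∫ x, L (ψ x) • v x := by
      intro L
      have hp : pderiv i (fun x => L (ψ x)) = fun x => L (ψ' x) := by
        funext x
        unfold pderiv
        rw [hψ', SchwartzMap.lineDerivOp_apply_eq_fderiv]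
        have : HasFDerivAt (fun x => L (ψ x)) (L ∘L fderiv ℝ ψ x) x :=
          L.hasFDerivAt.comp x ψ.differentiableAt.hasFDerivAt
        rw [this.fderiv]
        rfl
      have := h.integral_of_memLp (φ := fun x => L (ψ x)) (L.contDiff.comp (ψ.smooth ⊤))
        (L.comp_memLp' (ψ.memLp 2)) (by
          rw [hp]
          exact L.comp_memLp' (ψ'.memLp 2))
      rwa [hp] at this
    have split : ∀ (θ : 𝓢(EuclideanSpace ℝ (Fin n), ℂ)) (w : L2 ℂ n),
        ∫ x, θ x • w x = (∫ x, Complex.reCLM (θ x) • w x)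
          + Complex.I * ∫ x, Complex.imCLM (θ x) • w x := by
      intro θ w
      have h1 : Integrable fun x => Complex.reCLM (θ x) • w x :=
        integrable_smul_of_memLp_two (Complex.reCLM.comp_memLp' (θ.memLp 2)) w
      have h2 : Integrable fun x => Complex.imCLM (θ x) • w x :=
        integrable_smul_of_memLp_two (Complex.imCLM.comp_memLp' (θ.memLp 2)) w
      rw [← integral_const_mul, ← integral_add h1 (h2.const_mul _)]
      congr 1
      funext x
      simp only [Complex.reCLM_apply, Complex.imCLM_apply, Complex.real_smul, smul_eq_mul]
      conv_lhs => rw [← Complex.re_add_im (θ x)]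
      ring
    rw [split, split, key, key]
    ring
  · intro h φ hφ
    rw [integral_isTest_smul (hφ.pderiv i), integral_isTest_smul hφ, ← h,
      TemperedDistribution.lineDerivOp_apply_apply, map_neg, neg_neg,
      hφ.lineDerivOp_toSchwartz]

lemma IsTest.laplacian_toSchwartz {φ : EuclideanSpace ℝ (Fin n) → ℝ} (hφ : IsTest φ) :
    Δ hφ.toSchwartz = (isTest_laplacian hφ).toSchwartz := by
  rw [SchwartzMap.laplacian_eq_sum (EuclideanSpace.basisFun (Fin n) ℝ)]
  simp only [EuclideanSpace.basisFun_apply, hφ.lineDerivOp_toSchwartz,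
    (hφ.pderiv _).lineDerivOp_toSchwartz]
  ext x
  rw [sum_apply, IsTest.toSchwartz_apply, laplacian_eq hφ]
  simp

lemma hasDistribLaplacian_of_laplacian_eq
    (h : Δ (Lp.toTemperedDistribution u) = Lp.toTemperedDistribution f) :
    HasDistribLaplacian u f := by
  intro φ hφ
  rw [integral_isTest_smul (isTest_laplacian hφ), integral_isTest_smul hφ, ← h,
    TemperedDistribution.laplacian_apply_apply, hφ.laplacian_toSchwartz]

/-- For `u ∈ H²` the sum of the pure second derivatives is the tempered Laplacian, and uniqueness of
the distributional Laplacian identifies it with `f`. -/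
lemma HasDistribLaplacian.laplacian_eq (h : HasDistribLaplacian u f) (hu : MemH2 u) :
    Δ (Lp.toTemperedDistribution u) = Lp.toTemperedDistribution f := by
  obtain ⟨g, k, hg, hk⟩ := hu
  have e : Δ (Lp.toTemperedDistribution u) = Lp.toTemperedDistribution (∑ i, k i i) := by
    rw [TemperedDistribution.laplacian_eq_sum (EuclideanSpace.basisFun (Fin n) ℝ),
      ← Lp.toTemperedDistributionCLM_apply (∑ i, k i i), map_sum]
    refine Finset.sum_congr rfl fun i _ => ?_
    rw [EuclideanSpace.basisFun_apply, hasWeakPartial_iff_lineDerivOp_eq.1 (hg i),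
      hasWeakPartial_iff_lineDerivOp_eq.1 (hk i i)]
    rfl
  rw [e, h.unique (hasDistribLaplacian_of_laplacian_eq e)]

end Distributions

/-! ### The multiplier `(M + 4π²|ξ|²)⁻¹` inverts `-Δ + M` on `H²`. -/

section FreeResolvent

open SchwartzMap LineDeriv FourierTransform

variable {n : ℕ} {m : EuclideanSpace ℝ (Fin n) → ℂ} {M : ℝ}

lemma toTemperedDistribution_injective {u v : L2 ℂ n}
    (h : Lp.toTemperedDistribution u = Lp.toTemperedDistribution v) : u = v :=
  LinearMap.ker_eq_bot.1 (Lp.ker_toTemperedDistributionCLM_eq_bot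
    (F := ℂ) (μ := (volume : Measure (EuclideanSpace ℝ (Fin n)))) (p := 2)) h

/-- Lets symbols be multiplied among tempered distributions, where the unbounded `ξ i` and `‖ξ‖ ^ 2`
are admissible, and the result be read in `L²`. -/
lemma toTemperedDistribution_fourierMul (hm : m.HasTemperateGrowth) (hb : MemLp m ⊤ volume)
    (f : L2 ℂ n) :
    Lp.toTemperedDistribution (fourierMul hb.toLp f)
      = TemperedDistribution.fourierMultiplierCLM ℂ m (Lp.toTemperedDistribution f) := by
  have h : mulBdd hb.toLp (𝓕 f) = (hb.toLp • (𝓕 f : L2 ℂ n) : L2 ℂ n) :=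
    Lp.ext ((mulBdd_coeFn _ _).trans (Lp.coeFn_lpSMul (r := 2) hb.toLp (𝓕 f : L2 ℂ n)).symm)
  rw [fourierMul_apply, ← Lp.fourierInv_toTemperedDistribution_eq,
    TemperedDistribution.fourierMultiplierCLM_apply, Lp.fourier_toTemperedDistribution_eq, h,
    Lp.toTemperedDistribution_smul_eq hm]

lemma hasWeakPartial_fourierMul (i : Fin n) (hm : m.HasTemperateGrowth) (hb : MemLp m ⊤ volume)
    (hb' : MemLp (m * fun ξ => (ξ i : ℂ)) ⊤ volume) (f : L2 ℂ n) :
    HasWeakPartial i (fourierMul hb.toLp f)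
      ((2 * Real.pi * Complex.I) • fourierMul hb'.toLp f) := by
  have e : (fun ξ : EuclideanSpace ℝ (Fin n) =>
      ((inner ℝ ξ (EuclideanSpace.single i (1 : ℝ)) : ℝ) : ℂ)) = fun ξ => (ξ i : ℂ) := by
    funext ξ
    simp [EuclideanSpace.inner_single_right]
  have hi : (fun ξ : EuclideanSpace ℝ (Fin n) => (ξ i : ℂ)).HasTemperateGrowth := by
    rw [← e]
    fun_prop
  rw [hasWeakPartial_iff_lineDerivOp_eq, TemperedDistribution.lineDeriv_eq_fourierMultiplierCLM,
    toTemperedDistribution_fourierMul hm, e,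
    TemperedDistribution.fourierMultiplierCLM_fourierMultiplierCLM_apply hm hi,
    ← Lp.toTemperedDistributionCLM_apply (_ • _), map_smul, Lp.toTemperedDistributionCLM_apply,
    toTemperedDistribution_fourierMul (hm.mul hi)]

lemma hasTemperateGrowth_resolventSymbol (hM : 0 < M) :
    (resolventSymbol M : EuclideanSpace ℝ (Fin n) → ℂ).HasTemperateGrowth := by
  -- The symbol is `M⁻¹ (1 + ‖η‖²)⁻¹` at `η = (2π/√M) ξ`.
  have h1 := Function.hasTemperateGrowth_one_add_norm_sq_rpow (EuclideanSpace ℝ (Fin n)) (-1)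
  have h2 : (fun ξ : EuclideanSpace ℝ (Fin n) =>
      (2 * Real.pi / Real.sqrt M) • ξ).HasTemperateGrowth := by fun_prop
  have h3 := (Function.HasTemperateGrowth.const (E := EuclideanSpace ℝ (Fin n)) M⁻¹).mul
    (h1.comp h2)
  have h4 := Function.Complex.hasTemperateGrowth_ofReal.comp h3
  refine (congrArg Function.HasTemperateGrowth (funext fun ξ => ?_)).mpr h4
  simp only [resolventSymbol, Function.comp_apply, Pi.mul_apply, norm_smul]
  congr 1
  rw [Real.rpow_neg_one, Real.norm_of_nonneg (r := 2 * Real.pi / √M) (by positivity),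
    mul_pow (2 * Real.pi / √M), div_pow, Real.sq_sqrt hM.le, ← mul_inv]
  congr 1
  field_simp

lemma norm_resolventSymbol_mul_le (hM : 0 < M) (ξ : EuclideanSpace ℝ (Fin n)) :
    ‖resolventSymbol M ξ‖ * ‖ξ‖ ^ 2 ≤ 1 := by
  rw [norm_resolventSymbol_eq hM, inv_mul_le_iff₀ (by positivity), mul_one]
  have h1 : 1 ≤ (2 * Real.pi) ^ 2 := by nlinarith [Real.pi_gt_three]
  nlinarith [sq_nonneg ‖ξ‖]

/-- The resolvent symbol stays bounded after multiplication by `ξ i` or `ξ i * ξ j`, so the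
derivatives up to order two are again multipliers on `L²`. For first order, `‖ξ‖ ≤ 1 + ‖ξ‖ ^ 2`
gives the bound `M⁻¹ + 1`. -/
lemma freeResolvent_memH2 (hM : 0 < M) (f : L2 ℂ n) : MemH2 (freeResolvent n hM f) := by
  have hg := hasTemperateGrowth_resolventSymbol (n := n) hM
  have hi : ∀ i : Fin n, (fun ξ : EuclideanSpace ℝ (Fin n) => (ξ i : ℂ)).HasTemperateGrowth :=
    fun i => Function.Complex.hasTemperateGrowth_ofReal.comp
      (EuclideanSpace.proj (𝕜 := ℝ) i).hasTemperateGrowth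
  have hle : ∀ (ξ : EuclideanSpace ℝ (Fin n)) i, ‖(ξ i : ℂ)‖ ≤ ‖ξ‖ := fun ξ i => by
    rw [Complex.norm_real]
    exact PiLp.norm_apply_le ξ i
  have hb1 : ∀ i : Fin n, MemLp (resolventSymbol M * fun ξ : EuclideanSpace ℝ (Fin n) =>
      (ξ i : ℂ)) ⊤ volume := fun i => by
    refine memLp_top_of_bound (hg.mul (hi i)).1.continuous.aestronglyMeasurable (M⁻¹ + 1)
      (Eventually.of_forall fun ξ => ?_)
    rw [Pi.mul_apply, norm_mul]
    have h1 := norm_resolventSymbol_le hM ξ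
    have h2 := norm_resolventSymbol_mul_le hM ξ
    have h3 := norm_nonneg (resolventSymbol M ξ)
    have h4 : ‖ξ‖ ≤ 1 + ‖ξ‖ ^ 2 := by nlinarith [sq_nonneg (‖ξ‖ - 1), sq_nonneg ‖ξ‖]
    nlinarith [mul_le_mul_of_nonneg_left ((hle ξ i).trans h4) h3]
  have hb2 : ∀ i j : Fin n, MemLp ((resolventSymbol M * fun ξ : EuclideanSpace ℝ (Fin n) =>
      (ξ i : ℂ)) * fun ξ => (ξ j : ℂ)) ⊤ volume := fun i j => by
    refine memLp_top_of_bound ((hg.mul (hi i)).mul (hi j)).1.continuous.aestronglyMeasurable 1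
      (Eventually.of_forall fun ξ => ?_)
    rw [Pi.mul_apply, Pi.mul_apply, norm_mul, norm_mul, mul_assoc]
    refine le_trans ?_ (norm_resolventSymbol_mul_le hM ξ)
    rw [sq]
    gcongr <;> exact hle ξ _
  exact ⟨fun i => (2 * Real.pi * Complex.I) • fourierMul (hb1 i).toLp f,
    fun i j => (2 * Real.pi * Complex.I) • (2 * Real.pi * Complex.I) •
      fourierMul (hb2 i j).toLp f,
    fun i => hasWeakPartial_fourierMul i hg _ (hb1 i) f,
    fun i j => (hasWeakPartial_fourierMul j (hg.mul (hi i)) (hb1 i) (hb2 i j) f).smul _⟩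

lemma hasTemperateGrowth_normSq :
    (fun ξ : EuclideanSpace ℝ (Fin n) => Complex.ofReal (‖ξ‖ ^ 2)).HasTemperateGrowth :=
  Function.Complex.hasTemperateGrowth_ofReal.comp (Function.hasTemperateGrowth_norm_sq _)

lemma fourierMultiplierCLM_add_apply {m₁ m₂ : EuclideanSpace ℝ (Fin n) → ℂ}
    (h₁ : m₁.HasTemperateGrowth) (h₂ : m₂.HasTemperateGrowth)
    (T : TemperedDistribution (EuclideanSpace ℝ (Fin n)) ℂ) :
    TemperedDistribution.fourierMultiplierCLM ℂ (m₁ + m₂) T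
      = TemperedDistribution.fourierMultiplierCLM ℂ m₁ T
        + TemperedDistribution.fourierMultiplierCLM ℂ m₂ T := by
  simp only [TemperedDistribution.fourierMultiplierCLM_apply,
    TemperedDistribution.smulLeftCLM_add h₁ h₂, add_apply, fourierInv_add]

/-- The symbols `(M + (2π)²|ξ|²)⁻¹` and `M + (2π)²|ξ|²` are inverse to each other. -/
lemma fourierMultiplier_resolventSymbol_eq (hM : 0 < M)
    (T : TemperedDistribution (EuclideanSpace ℝ (Fin n)) ℂ) :
    (M : ℂ) • TemperedDistribution.fourierMultiplierCLM ℂ (resolventSymbol M) T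
      + ((2 * Real.pi) ^ 2 : ℂ) • TemperedDistribution.fourierMultiplierCLM ℂ
        (resolventSymbol M * fun ξ => Complex.ofReal (‖ξ‖ ^ 2)) T = T := by
  have hg := hasTemperateGrowth_resolventSymbol (n := n) hM
  have hg' := hg.mul (hasTemperateGrowth_normSq (n := n))
  have h1 : ((M : ℂ) • resolventSymbol M : EuclideanSpace ℝ (Fin n) → ℂ).HasTemperateGrowth :=
    (Function.HasTemperateGrowth.const (M : ℂ)).mul hg
  have h2 : (((2 * Real.pi) ^ 2 : ℂ) • (resolventSymbol M * fun ξ => Complex.ofReal (‖ξ‖ ^ 2)) :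
      EuclideanSpace ℝ (Fin n) → ℂ).HasTemperateGrowth :=
    (Function.HasTemperateGrowth.const ((2 * Real.pi) ^ 2 : ℂ)).mul hg'
  rw [← smul_apply, ← smul_apply, ← TemperedDistribution.fourierMultiplierCLM_smul hg,
    ← TemperedDistribution.fourierMultiplierCLM_smul hg', ← fourierMultiplierCLM_add_apply h1 h2]
  have e : ((M : ℂ) • resolventSymbol M
      + ((2 * Real.pi) ^ 2 : ℂ) • (resolventSymbol M * fun ξ => Complex.ofReal (‖ξ‖ ^ 2)) :
      EuclideanSpace ℝ (Fin n) → ℂ) = fun _ => 1 := by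
    funext ξ
    have h0 : M + (2 * Real.pi) ^ 2 * ‖ξ‖ ^ 2 ≠ 0 := by positivity
    simp only [Pi.add_apply, Pi.smul_apply, Pi.mul_apply, resolventSymbol, smul_eq_mul]
    norm_cast
    field_simp
  rw [e, TemperedDistribution.fourierMultiplierCLM_const]
  simp

lemma hasDistribLaplacian_freeResolvent (hM : 0 < M) (f : L2 ℂ n) :
    HasDistribLaplacian (freeResolvent n hM f) ((M : ℂ) • freeResolvent n hM f - f) := by
  have hg := hasTemperateGrowth_resolventSymbol (n := n) hM
  refine hasDistribLaplacian_of_laplacian_eq ?_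
  have h := fourierMultiplier_resolventSymbol_eq hM (Lp.toTemperedDistribution f)
  rw [← Lp.toTemperedDistributionCLM_apply (_ - f), map_sub, map_smul,
    Lp.toTemperedDistributionCLM_apply, Lp.toTemperedDistributionCLM_apply, freeResolvent,
    toTemperedDistribution_fourierMul hg,
    TemperedDistribution.laplacian_eq_fourierMultiplierCLM,
    TemperedDistribution.fourierMultiplierCLM_fourierMultiplierCLM_apply
      hg hasTemperateGrowth_normSq, ← Complex.coe_smul]
  linear_combination (norm := (push_cast; module)) (-1 : ℂ) • h

/-- The left inverse, matching the right inverse in `hasDistribLaplacian_freeResolvent`; `H²`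
membership makes the Laplacian available as a tempered distribution. -/
lemma freeResolvent_sub_laplacian (hM : 0 < M) {u v : L2 ℂ n} (hu : MemH2 u)
    (h : HasDistribLaplacian u v) : freeResolvent n hM ((M : ℂ) • u - v) = u := by
  have hg := hasTemperateGrowth_resolventSymbol (n := n) hM
  apply toTemperedDistribution_injective
  have h' := fourierMultiplier_resolventSymbol_eq hM (Lp.toTemperedDistribution u)
  rw [freeResolvent, toTemperedDistribution_fourierMul hg,
    ← Lp.toTemperedDistributionCLM_apply (_ - v), map_sub, map_smul,
    Lp.toTemperedDistributionCLM_apply, Lp.toTemperedDistributionCLM_apply, ← h.laplacian_eq hu,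
    TemperedDistribution.laplacian_eq_fourierMultiplierCLM, ← Complex.coe_smul, map_sub,
    map_smul, map_smul, TemperedDistribution.fourierMultiplierCLM_fourierMultiplierCLM_apply
      hasTemperateGrowth_normSq hg, mul_comm (fun ξ => Complex.ofReal (‖ξ‖ ^ 2))]
  conv_rhs => rw [← h']
  push_cast
  module

end FreeResolvent

/-! ### From `-Δ + M` to `-Δ + α₁` by a Neumann series. -/

section Perturbation

variable {n : ℕ} {α : EuclideanSpace ℝ (Fin n) → ℝ} {ν : ℝ}

lemma mem_domain_schroedingerOp_iff {𝕜 : Type*} [RCLike 𝕜] {u : L2 𝕜 n} :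
    u ∈ (schroedingerOp 𝕜 α).domain ↔ MemH2 u ∧ u ∈ (mulOp 𝕜 α).domain := Iff.rfl

lemma schroedingerOp_eq {𝕜 : Type*} [RCLike 𝕜] {u v : L2 𝕜 n}
    (hu : u ∈ (schroedingerOp 𝕜 α).domain) (hm : u ∈ (mulOp 𝕜 α).domain)
    (h : HasDistribLaplacian u v) :
    schroedingerOp 𝕜 α ⟨u, hu⟩ = -v + mulOp 𝕜 α ⟨u, hm⟩ := by
  have hH : u ∈ H2 𝕜 n := (mem_domain_schroedingerOp_iff.1 hu).1
  rw [h.unique (laplacianOp_spec ⟨u, hH⟩)]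
  rfl

/-- `-Δ + α` has a bounded inverse, obtained from a free resolvent by a Neumann series. -/
lemma exists_isBoundedInverse_schroedingerOp (hα : MemLp α ⊤ volume) (hν : 0 < ν)
    (hαν : ∀ᵐ x, ν ≤ α x) :
    ∃ (M : ℝ) (hM : 0 < M) (K : L2 ℂ n →L[ℂ] L2 ℂ n),
      IsBoundedInverse (schroedingerOp ℂ α) (freeResolvent n hM ∘L K) := by
  -- With `ν ≤ α ≤ M` almost everywhere, `α - M` lies in `[ν - M, 0]`; the maximum with `ν` secures
  -- `0 < M` and `0 ≤ M - ν`.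
  let M : ℝ := max (eLpNorm α ⊤ volume).toReal ν
  have hM : 0 < M := hν.trans_le (le_max_right _ _)
  have hαM : ∀ᵐ x, α x ≤ M := by
    have h1 := ae_le_eLpNormEssSup (f := α) (μ := volume)
    rw [← eLpNorm_exponent_top] at h1
    filter_upwards [h1] with x hx
    have h2 := ENNReal.toReal_mono hα.2.ne hx
    rw [toReal_enorm] at h2
    exact ((le_abs_self _).trans h2).trans (le_max_left _ _)
  have hβ : MemLp (fun x => ((α x - M : ℝ) : ℂ)) ⊤ volume :=
    (hα.sub (memLp_top_const M)).ofReal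
  let B : L2 ℂ n →L[ℂ] L2 ℂ n := mulBdd hβ.toLp
  have hB : ‖B‖ ≤ M - ν := by
    refine norm_mulBdd_le (sub_nonneg.2 (le_max_right _ _)) ?_
    filter_upwards [hβ.coeFn_toLp, hαM, hαν] with x h1 h2 h3
    rw [h1, Complex.norm_real, Real.norm_eq_abs, abs_le]
    constructor <;> linarith
  have hmul : IsComp (mulOp ℂ α) (ContinuousLinearMap.id ℂ _)
      ((M : ℂ) • ContinuousLinearMap.id ℂ _ + B) := by
    refine isComp_mulOp_iff.2 fun f => ?_
    have e : ((M : ℂ) • ContinuousLinearMap.id ℂ (L2 ℂ n) + B) f = (M : ℂ) • f + B f := rfl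
    rw [e]
    filter_upwards [Lp.coeFn_add ((M : ℂ) • f) (B f), Lp.coeFn_smul (M : ℂ) f,
      mulBdd_coeFn hβ.toLp f, hβ.coeFn_toLp] with x h1 h2 h3 h4
    rw [h1, Pi.add_apply, h2, Pi.smul_apply, h3, h4, ContinuousLinearMap.id_apply,
      Complex.real_smul, smul_eq_mul]
    push_cast
    ring
  have hA : ∀ u v, MemH2 u → HasDistribLaplacian u v →
      ∃ h : u ∈ (schroedingerOp ℂ α).domain,
        schroedingerOp ℂ α ⟨u, h⟩ = -v + ((M : ℂ) • u + B u) := by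
    intro u v hu hv
    obtain ⟨h1, h2⟩ := hmul u
    have h3 := mem_domain_schroedingerOp_iff.2 ⟨hu, h1⟩
    exact ⟨h3, (schroedingerOp_eq h3 h1 hv).trans (congrArg _ h2.symm)⟩
  let R := freeResolvent n hM
  have hlt : ‖-(B ∘L R)‖ < 1 := by
    rw [norm_neg]
    calc ‖B ∘L R‖ ≤ ‖B‖ * ‖R‖ := ContinuousLinearMap.opNorm_comp_le _ _
      _ ≤ (M - ν) * M⁻¹ := by
          gcongr
          · exact (norm_nonneg _).trans hB
          · exact norm_freeResolvent_le hM
      _ < 1 := by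
          rw [mul_inv_lt_iff₀ hM]
          linarith
  -- `U = 1 + B R` equals `(-Δ + α) R`, whence the inverse `R U⁻¹`.
  let U := Units.oneSub (-(B ∘L R)) hlt
  have hU : ∀ f, (U : L2 ℂ n →L[ℂ] L2 ℂ n) f = f + B (R f) := fun f => by
    simp [U]
  have hU1 : ∀ f, (U : L2 ℂ n →L[ℂ] L2 ℂ n) ((U⁻¹ : (L2 ℂ n →L[ℂ] L2 ℂ n)ˣ).1 f) = f := fun f =>
    congrArg (fun T : L2 ℂ n →L[ℂ] L2 ℂ n => T f) U.mul_inv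
  have hU2 : ∀ f, (U⁻¹ : (L2 ℂ n →L[ℂ] L2 ℂ n)ˣ).1 ((U : L2 ℂ n →L[ℂ] L2 ℂ n) f) = f := fun f =>
    congrArg (fun T : L2 ℂ n →L[ℂ] L2 ℂ n => T f) U.inv_mul
  refine ⟨M, hM, (U⁻¹ : (L2 ℂ n →L[ℂ] L2 ℂ n)ˣ).1, fun f => ?_, fun u => ?_⟩
  · set w := (U⁻¹ : (L2 ℂ n →L[ℂ] L2 ℂ n)ˣ).1 f with hw
    obtain ⟨h, e⟩ := hA (R w) _ (freeResolvent_memH2 hM w) (hasDistribLaplacian_freeResolvent hM w)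
    refine ⟨h, e.trans ?_⟩
    calc _ = w + B (R w) := by simp only [R]; abel
      _ = f := by rw [← hU, hw, hU1]
  · obtain ⟨u, hu⟩ := u
    have hH := (mem_domain_schroedingerOp_iff.1 hu).1
    obtain ⟨v, hv⟩ := exists_hasDistribLaplacian ⟨u, hH⟩
    obtain ⟨h, e⟩ := hA u v hH hv
    have h1 : R ((M : ℂ) • u - v) = u := freeResolvent_sub_laplacian hM hH hv
    have h2 : schroedingerOp ℂ α ⟨u, hu⟩ = (U : L2 ℂ n →L[ℂ] L2 ℂ n) ((M : ℂ) • u - v) := by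
      rw [hU, h1, e]
      abel
    rw [h2, ContinuousLinearMap.comp_apply, hU2]
    exact h1

end Perturbation

/-! ### Transfer between complex scalars and `𝕜`. -/

section ScalarChange

variable {𝕜 𝕜' : Type*} [RCLike 𝕜] [RCLike 𝕜'] {n : ℕ}

variable (n) in
/-- Composition with a real linear map of the scalars. -/
def mapL2 (l : 𝕜 →L[ℝ] 𝕜') : L2 𝕜 n →L[ℝ] L2 𝕜' n := l.compLpL 2 volume

lemma mapL2_coeFn (l : 𝕜 →L[ℝ] 𝕜') (u : L2 𝕜 n) : mapL2 n l u =ᵐ[volume] fun x => l (u x) :=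
  l.coeFn_compLpL u

lemma integral_smul_mapL2 (l : 𝕜 →L[ℝ] 𝕜') {φ : EuclideanSpace ℝ (Fin n) → ℝ} (hφ : IsTest φ)
    (u : L2 𝕜 n) : ∫ x, φ x • mapL2 n l u x = l (∫ x, φ x • u x) := by
  rw [← l.integral_comp_comm (integrable_smul_of_isTest hφ u)]
  refine integral_congr_ae ?_
  filter_upwards [mapL2_coeFn l u] with x hx
  rw [hx, map_smul]

lemma HasWeakPartial.mapL2 {i : Fin n} {u v : L2 𝕜 n} (h : HasWeakPartial i u v)
    (l : 𝕜 →L[ℝ] 𝕜') : HasWeakPartial i (mapL2 n l u) (mapL2 n l v) := by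
  intro φ hφ
  rw [integral_smul_mapL2 l (hφ.pderiv i), integral_smul_mapL2 l hφ, h φ hφ, map_neg]

lemma HasDistribLaplacian.mapL2 {u v : L2 𝕜 n} (h : HasDistribLaplacian u v)
    (l : 𝕜 →L[ℝ] 𝕜') : HasDistribLaplacian (mapL2 n l u) (mapL2 n l v) := by
  intro φ hφ
  rw [integral_smul_mapL2 l (isTest_laplacian hφ), integral_smul_mapL2 l hφ, h φ hφ]

lemma MemH2.mapL2 {u : L2 𝕜 n} (h : MemH2 u) (l : 𝕜 →L[ℝ] 𝕜') : MemH2 (mapL2 n l u) := by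
  obtain ⟨g, k, hg, hk⟩ := h
  exact ⟨fun i => Schroedinger.mapL2 n l (g i), fun i j => Schroedinger.mapL2 n l (k i j),
    fun i => (hg i).mapL2 l, fun i j => (hk i j).mapL2 l⟩

variable {α : EuclideanSpace ℝ (Fin n) → ℝ}

lemma mulOp_mapL2 (l : 𝕜 →L[ℝ] 𝕜') {u : L2 𝕜 n} (hu : u ∈ (mulOp 𝕜 α).domain) :
    ∃ h : mapL2 n l u ∈ (mulOp 𝕜' α).domain,
      mulOp 𝕜' α ⟨mapL2 n l u, h⟩ = mapL2 n l (mulOp 𝕜 α ⟨u, hu⟩) := by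
  have hm : MemLp (fun x => α x • u x) 2 volume := hu
  have e : (fun x => α x • mapL2 n l u x) =ᵐ[volume] mapL2 n l (hm.toLp) := by
    filter_upwards [mapL2_coeFn l u, mapL2_coeFn l hm.toLp, hm.coeFn_toLp] with x h1 h2 h3
    rw [h1, h2, h3, map_smul]
  have hm' : MemLp (fun x => α x • mapL2 n l u x) 2 volume :=
    (memLp_congr_ae e).2 (Lp.memLp _)
  exact ⟨hm', Lp.ext (hm'.coeFn_toLp.trans e)⟩

/-- The coefficient and the test functions are real, so every real linear map of the scalars
commutes with the operator. -/
lemma schroedingerOp_mapL2 (l : 𝕜 →L[ℝ] 𝕜') {u : L2 𝕜 n}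
    (hu : u ∈ (schroedingerOp 𝕜 α).domain) :
    ∃ h : mapL2 n l u ∈ (schroedingerOp 𝕜' α).domain,
      schroedingerOp 𝕜' α ⟨mapL2 n l u, h⟩ = mapL2 n l (schroedingerOp 𝕜 α ⟨u, hu⟩) := by
  obtain ⟨hH, hm⟩ := mem_domain_schroedingerOp_iff.1 hu
  obtain ⟨h, e⟩ := mulOp_mapL2 l hm
  obtain ⟨v, hv⟩ := exists_hasDistribLaplacian ⟨u, hH⟩
  have h' := mem_domain_schroedingerOp_iff.2 ⟨hH.mapL2 l, h⟩
  exact ⟨h', by rw [schroedingerOp_eq h' h (hv.mapL2 l), schroedingerOp_eq hu hm hv, map_add,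
    map_neg, e]⟩

variable (𝕜 𝕜') in
/-- The real linear map `a + i b ↦ a + i b` between two fields of scalars. -/
def scalarMap : 𝕜 →L[ℝ] 𝕜' :=
  RCLike.ofRealCLM ∘L RCLike.reCLM +
    ContinuousLinearMap.smulRight RCLike.imCLM (RCLike.I : 𝕜')

lemma scalarMap_apply (z : 𝕜) :
    scalarMap 𝕜 𝕜' z = (RCLike.re z : 𝕜') + (RCLike.im z : 𝕜') * RCLike.I := by
  simp [scalarMap, RCLike.real_smul_eq_coe_mul]

/-- Only this order is the identity for every `𝕜`: over the reals, passing from `ℂ` to `𝕜` discards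
the imaginary part. -/
lemma mapL2_scalarMap_scalarMap (u : L2 𝕜 n) :
    mapL2 n (scalarMap ℂ 𝕜) (mapL2 n (scalarMap 𝕜 ℂ) u) = u := by
  refine Lp.ext ?_
  filter_upwards [mapL2_coeFn (scalarMap ℂ 𝕜) (mapL2 n (scalarMap 𝕜 ℂ) u),
    mapL2_coeFn (scalarMap 𝕜 ℂ) u] with x h1 h2
  rw [h1, h2, scalarMap_apply, scalarMap_apply]
  simp [RCLike.re_add_im]

lemma mapL2_scalarMap_smul_I (hI : (RCLike.I : 𝕜) ≠ 0) (hI' : (RCLike.I : 𝕜') ≠ 0)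
    (u : L2 𝕜 n) :
    mapL2 n (scalarMap 𝕜 𝕜') ((RCLike.I : 𝕜) • u)
      = (RCLike.I : 𝕜') • mapL2 n (scalarMap 𝕜 𝕜') u := by
  refine Lp.ext ?_
  have h𝕜 : RCLike.im (RCLike.I : 𝕜) = 1 := (RCLike.I_eq_zero_or_im_I_eq_one (K := 𝕜)).resolve_left hI
  filter_upwards [mapL2_coeFn (scalarMap 𝕜 𝕜') ((RCLike.I : 𝕜) • u),
    mapL2_coeFn (scalarMap 𝕜 𝕜') u, Lp.coeFn_smul (RCLike.I : 𝕜) u,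
    Lp.coeFn_smul (RCLike.I : 𝕜') (mapL2 n (scalarMap 𝕜 𝕜') u)] with x h1 h2 h3 h4
  rw [h1, h3, h4, Pi.smul_apply, Pi.smul_apply, h2, scalarMap_apply, scalarMap_apply]
  have := RCLike.I_mul_I_of_nonzero hI'
  simp only [smul_eq_mul, RCLike.mul_re, RCLike.mul_im, RCLike.I_re, h𝕜]
  push_cast
  linear_combination (-(RCLike.im (u x) : 𝕜')) * this

/-- The `𝕜`-linear operator induced by a complex linear operator. -/
lemma exists_clm_eq_mapL2 (T : L2 ℂ n →L[ℂ] L2 ℂ n) :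
    ∃ T' : L2 𝕜 n →L[𝕜] L2 𝕜 n, ∀ f,
      T' f = mapL2 n (scalarMap ℂ 𝕜) (T (mapL2 n (scalarMap 𝕜 ℂ) f)) := by
  let P : L2 𝕜 n →L[ℝ] L2 𝕜 n :=
    mapL2 n (scalarMap ℂ 𝕜) ∘L T.restrictScalars ℝ ∘L mapL2 n (scalarMap 𝕜 ℂ)
  have hI : ∀ f, P ((RCLike.I : 𝕜) • f) = (RCLike.I : 𝕜) • P f := by
    intro f
    -- In the real case `I = 0` and the claim is trivial; otherwise `I` corresponds to the complex
    -- unit.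
    by_cases h : (RCLike.I : 𝕜) = 0
    · rw [h, zero_smul, zero_smul, map_zero]
    · have h' : (RCLike.I : ℂ) ≠ 0 := Complex.I_ne_zero
      simp only [P, ContinuousLinearMap.comp_apply, ContinuousLinearMap.coe_restrictScalars']
      rw [mapL2_scalarMap_smul_I h h', map_smul, mapL2_scalarMap_smul_I h' h]
  have hr : ∀ (r : ℝ) (f : L2 𝕜 n), (r : 𝕜) • f = r • f := fun r f => by
    refine Lp.ext ?_
    filter_upwards [Lp.coeFn_smul (r : 𝕜) f, Lp.coeFn_smul r f] with x h1 h2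
    rw [h1, h2, Pi.smul_apply, Pi.smul_apply, RCLike.real_smul_eq_coe_mul, smul_eq_mul]
  have hc : ∀ (c : 𝕜) f, P (c • f) = c • P f := by
    intro c f
    rw [← RCLike.re_add_im c, add_smul, add_smul, mul_smul, mul_smul, map_add, hr, hr, hr, hr,
      map_smul, map_smul, hI]
  exact ⟨⟨⟨⟨P, map_add P⟩, hc⟩, P.continuous⟩, fun f => rfl⟩

end ScalarChange

end Schroedinger

end

/-! ### Assembly over `ℂ` and transfer to `𝕜`. -/

theorem lemma3p1 {𝕜 : Type*} [RCLike 𝕜] (n : ℕ) (hn : 3 ≤ n)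
    (α₁ α₂ : EuclideanSpace ℝ (Fin n) → ℝ)
    (hα₁ : MemLp α₁ ⊤ volume) (ν : ℝ) (hν : 0 < ν) (hα₁ν : ∀ᵐ x, ν ≤ α₁ x)
    (ρ : ℝ≥0∞) (hnρ : (n : ℝ≥0∞) ≤ ρ) (hρ : ρ < ⊤) (hα₂ : MemLp α₂ ρ volume) :
    (∃ R T : Schroedinger.L2 𝕜 n →L[𝕜] Schroedinger.L2 𝕜 n,
      Schroedinger.IsBoundedInverse (Schroedinger.schroedingerOp 𝕜 α₁) R ∧
      Schroedinger.IsComp (Schroedinger.mulOp 𝕜 α₂) R T ∧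
      IsCompactOperator T) ∧
    Schroedinger.IsRelativelyCompact (Schroedinger.schroedingerOp 𝕜 α₁)
      (Schroedinger.mulOp 𝕜 α₂) := by
  have h2ρ : 2 ≤ ρ := le_trans (by exact_mod_cast (by omega : 2 ≤ n)) hnρ
  obtain ⟨M, hM, K, hR⟩ := Schroedinger.exists_isBoundedInverse_schroedingerOp hα₁ hν hα₁ν
  obtain ⟨T, hT, hTc⟩ := Schroedinger.exists_isComp_freeResolvent hM h2ρ hnρ hρ hα₂
  -- Since the inverse is the free resolvent followed on the right by the bounded factor `K`, its
  -- product with `α₂` is `T ∘L K`, still compact.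
  have hT' := hT.comp_right K
  obtain ⟨R', hR'⟩ := Schroedinger.exists_clm_eq_mapL2 (𝕜 := 𝕜)
    (Schroedinger.freeResolvent n hM ∘L K)
  obtain ⟨S, hS⟩ := Schroedinger.exists_clm_eq_mapL2 (𝕜 := 𝕜) (T ∘L K)
  have hinv : Schroedinger.IsBoundedInverse (Schroedinger.schroedingerOp 𝕜 α₁) R' := by
    refine ⟨fun f => ?_, fun u => ?_⟩
    · obtain ⟨h1, e1⟩ := hR.right_inv (Schroedinger.mapL2 n (Schroedinger.scalarMap 𝕜 ℂ) f)
      obtain ⟨h2, e2⟩ := Schroedinger.schroedingerOp_mapL2 (Schroedinger.scalarMap ℂ 𝕜) h1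
      simp only [hR']
      exact ⟨h2, by rw [e2, e1, Schroedinger.mapL2_scalarMap_scalarMap]⟩
    · obtain ⟨h1, e1⟩ := Schroedinger.schroedingerOp_mapL2 (Schroedinger.scalarMap 𝕜 ℂ) u.2
      rw [hR', ← e1, hR.left_inv, Schroedinger.mapL2_scalarMap_scalarMap]
  have hcomp : Schroedinger.IsComp (Schroedinger.mulOp 𝕜 α₂) R' S := by
    intro f
    obtain ⟨h1, e1⟩ := hT' (Schroedinger.mapL2 n (Schroedinger.scalarMap 𝕜 ℂ) f)
    obtain ⟨h2, e2⟩ := Schroedinger.mulOp_mapL2 (Schroedinger.scalarMap ℂ 𝕜) h1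
    simp only [hR', hS]
    exact ⟨h2, by rw [e2, ← e1]⟩
  have hc : IsCompactOperator S := by
    have h1 : IsCompactOperator (T ∘L K) := hTc.comp_clm K
    have h2 := (h1.comp_clm (Schroedinger.mapL2 n (Schroedinger.scalarMap 𝕜 ℂ))).clm_comp
      (Schroedinger.mapL2 n (Schroedinger.scalarMap ℂ 𝕜))
    rwa [show (S : Schroedinger.L2 𝕜 n → Schroedinger.L2 𝕜 n) = _ from funext hS]
  exact ⟨⟨R', S, hinv, hcomp, hc⟩, .of_isComp hinv hcomp hc⟩
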